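/- Let $m\ge 0$, $n\ge 1$ be integers. For $a=(a_1,\dots,a_n)\in\mathbb{R}^n$ put $P_a(Z)=Z^n+\sum_{j=1}^n a_jZ^{n-j}$. For an open set $U\subseteq\mathbb{R}^m$ and an integer $k\ge 0$, let $C^{k,1}(U)$ be the space of all $f\in C^{k}(U)$ whose partial derivatives of order $k$ are locally Lipschitz; for $K\subseteq U$ put $$\|f\|_{C^{k,1}(K)}=\sup_{|\alpha|\le k}\,\sup_{x\in K}|\partial^\alpha f(x)|+\sup_{|\alpha|=k}\mathrm{Lip}_K(\partial^\alpha f),\qquad \mathrm{Lip}_K(g)=\sup_{x\ne y\in K}\frac{|g(x)-g(y)|}{\|x-y\|_2}.$$ A $C^{k,1}$-family of hyperbolic polynomials of degree $n$ on $U$ is a family $P_{a(x)}$, $x\in U$, with $a_1,\dots,a_n\in C^{k,1}(U)$ such that all roots of $P_{a(x)}$ are real for every $x\in U$. A continuous root of it is a continuous function $\lambda:U\to\mathbb{R}$ with $P_{a(x)}(\lambda(x))=0$ for all $x\in U$. Write $A\Subset B$ if $\overline A$ is compact and contained in the interior of $B$. **Theorem.** (1) Let $U\subseteq\mathbb{R}^m$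 be open and let $P_{a(x)}$, $x\in U$, be a $C^{p-1,1}$-family of hyperbolic polynomials of degree $n$, where $p\ge 1$ is the maximal multiplicity of the roots of the polynomials $P_{a(x)}$, $x\in U$ (or any integer $p\ge1$ such that all these multiplicities are at most $p$). Then every continuous root of the family is locally Lipschitz on $U$. (2) (The case $p=n$.) For every pair of sets $U_0\Subset U_1\subseteq\mathbb{R}^m$ there are finite constants $C(m,n,U_0,U_1)$ and $\tilde C(m,n,U_0,U_1)$, depending only on $m,n,U_0,U_1$, such that for every open $U$ with $U_1\Subset U$, every $C^{n-1,1}$-family $P_{a(x)}$, $x\in U$, of hyperbolic polynomials of degree $n$, and every continuous root $\lambda$ of it, $$\mathrm{Lip}_{U_0}(\lambda)\le C(m,n,U_0,U_1)\,\max_{1\le i\le n}\|a_i\|_{C^{n-1,1}(\overline U_1)}^{1/i}\le \tilde C(m,n,U_0,U_1)\,\Bigl(1+\max_{1\le i\le n}\|a_i\|_{C^{n-1,1}(\overline U_1)}\Bigr).$$ -/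

import Mathlib

open Polynomial
open scoped NNReal ENNReal Topology

noncomputable section

/-- The monic polynomial `Z ^ n + ∑_{j = 1}^n a_j Z ^ (n - j)`. The coefficient `a_j` is
`a ⟨j - 1, _⟩`, i.e. the index `j : Fin n` stands for `a_{j + 1}`. -/
def monicPoly {n : ℕ} (a : Fin n → ℝ) : ℝ[X] :=
  X ^ n + ∑ j : Fin n, C (a j) * X ^ (n - (j.val + 1))

/-- A real polynomial is hyperbolic if all its complex roots are real. -/
def IsHyperbolic (P : ℝ[X]) : Prop :=
  ∀ z : ℂ, aeval z P = 0 → z.im = 0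

/-- The iterated partial derivative `∂_{j 0} ⋯ ∂_{j (k - 1)} f` of order `k` at `x`. For `f` of
class `C^k` near `x` it does not depend on the order of the indices, and every `∂^α f` with
`|α| = k` is of this form. -/
def partialDeriv {m k : ℕ} (j : Fin k → Fin m) (f : EuclideanSpace ℝ (Fin m) → ℝ)
    (x : EuclideanSpace ℝ (Fin m)) : ℝ :=
  iteratedFDeriv ℝ k f x (fun l => EuclideanSpace.single (j l) (1 : ℝ))

/-- `f ∈ C^{k,1}(U)`, for `U` open: `f` is of class `C^k` on `U` and all its partial derivatives of
order `k` are locally Lipschitz on `U`. -/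
def IsCk1On {m : ℕ} (k : ℕ) (f : EuclideanSpace ℝ (Fin m) → ℝ)
    (U : Set (EuclideanSpace ℝ (Fin m))) : Prop :=
  ContDiffOn ℝ (k : WithTop ℕ∞) f U ∧
    ∀ j : Fin k → Fin m, LocallyLipschitzOn U (partialDeriv j f)

/-- The Lipschitz constant `Lip_K(f) = sup_{x ≠ y ∈ K} |f x - f y| / ‖x - y‖ ∈ [0, ∞]`, with respect
to the Euclidean norm. -/
def lipConst {m : ℕ} (K : Set (EuclideanSpace ℝ (Fin m))) (f : EuclideanSpace ℝ (Fin m) → ℝ) :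
    ℝ≥0∞ :=
  ⨆ (x ∈ K) (y ∈ K) (_ : x ≠ y), edist (f x) (f y) / edist x y

/-- `‖f‖_{C^k(K)}`: the supremum over `K` of the absolute values of all partial derivatives of
order at most `k`. -/
def ckNorm {m : ℕ} (k : ℕ) (K : Set (EuclideanSpace ℝ (Fin m)))
    (f : EuclideanSpace ℝ (Fin m) → ℝ) : ℝ≥0∞ :=
  ⨆ (l : ℕ) (_ : l ≤ k) (j : Fin l → Fin m) (x ∈ K), ‖partialDeriv j f x‖ₑ

/-- `‖f‖_{C^{k,1}(K)} = ‖f‖_{C^k(K)} + sup_{|α| = k} Lip_K(∂^α f)`. -/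
def ck1Norm {m : ℕ} (k : ℕ) (K : Set (EuclideanSpace ℝ (Fin m)))
    (f : EuclideanSpace ℝ (Fin m) → ℝ) : ℝ≥0∞ :=
  ckNorm k K f + ⨆ j : Fin k → Fin m, lipConst K (partialDeriv j f)

/-- `A ⋐ B`: the closure of `A` is compact and contained in the interior of `B`. -/
def CompactlyInside {m : ℕ} (A B : Set (EuclideanSpace ℝ (Fin m))) : Prop :=
  IsCompact (closure A) ∧ closure A ⊆ interior B

/-- `P_{a(x)}`, `x ∈ U`, is a `C^{k,1}` family of hyperbolic polynomials of degree `n`. -/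
def IsHyperbolicFamily {m n : ℕ} (k : ℕ) (U : Set (EuclideanSpace ℝ (Fin m)))
    (a : Fin n → EuclideanSpace ℝ (Fin m) → ℝ) : Prop :=
  (∀ i, IsCk1On k (a i) U) ∧ ∀ x ∈ U, IsHyperbolic (monicPoly fun i => a i x)

/-- `r` is a continuous root of the family `P_{a(x)}`, `x ∈ U`. -/
def IsContinuousRoot {m n : ℕ} (U : Set (EuclideanSpace ℝ (Fin m)))
    (a : Fin n → EuclideanSpace ℝ (Fin m) → ℝ) (r : EuclideanSpace ℝ (Fin m) → ℝ) : Prop :=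
  ContinuousOn r U ∧ ∀ x ∈ U, (monicPoly fun i => a i x).IsRoot (r x)

end

/-! This is Bronshtein's theorem, proved by induction on the degree in a form that is uniform over
arbitrary index types. In place of a compactness argument, the induction carries families whose
coefficients have uniformly bounded Taylor expansions at `0` (`IsJet`), and `RootsLipschitz n`
asserts one Lipschitz constant at `0` for the whole family.

Shifting by the mean of the roots makes the coefficient `a_1` vanish. Then the squares of the roots
add up to `-2 a_2`, so `a_2 ≤ 0`, and `a_2` controls every root. Being nonpositive with second order
jets, `a_2` obeys a Glaeser type inequality. If `a_2(0) = 0`, this gives `a_2 = O(t²)`, so the roots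
are `O(|t|)`. Otherwise put `δ = √(-a_2(0))`, divide the roots by `δ` and slow time down
proportionally to `δ`; slopes change only by a fixed factor. By Glaeser the rescaled `a_2` stays
bounded, hence so do all roots and coefficients, and a bounded rescaling of jets again has uniform
jets (`IsJet.rescale`), although `δ` has no positive lower bound. Now `a_2(0) = -1`, so the roots at
time `0` have a gap bounded below in terms of `n` (`exists_gap`). The polynomials split into factors
of lower degree with separated roots; the factors inherit the jets (`isJet_coeff_of_mul`, by a
resultant and Bézout argument), and the induction hypothesis applies.

Along segments, `C^{k,1}` coefficients have jets of order `k + 1` (`isJet_line`), and pointwise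
Lipschitz bounds with a common constant integrate to Lipschitz bounds on convex sets. In part (1),
only the cluster of roots near `r x₀` matters; it has at most `p` elements, so jets of order `p`
suffice. In part (2), all families with coefficients of norm at most one form a single index type,
so they share one constant; homogeneity of the roots then produces the exponents `1/i`. -/

/-! ### Families of functions with uniform jets -/

/-- A family `g i : ℝ → ℝ` has uniform jets of order `n` at `0`: on `[-1, 1]` it is a polynomial of
degree `< n` plus a remainder `O(|t| ^ n)`, with bounds that do not depend on `i`. -/
def IsJet {ι : Type} : ℕ → (ι → ℝ → ℝ) → Prop
  | 0, g => ∃ M : ℝ, ∀ i t, |t| ≤ 1 → |g i t| ≤ M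
  | n + 1, g => ∃ (c : ι → ℝ) (h : ι → ℝ → ℝ), (∃ M : ℝ, ∀ i, |c i| ≤ M) ∧ IsJet n h ∧
      ∀ i t, |t| ≤ 1 → g i t = c i + t * h i t

namespace IsJet

variable {ι : Type} {n : ℕ} {g h : ι → ℝ → ℝ}

lemma congr (hg : IsJet n g) (e : ∀ i t, |t| ≤ 1 → h i t = g i t) : IsJet n h := by
  cases n with
  | zero =>
    obtain ⟨M, hM⟩ := hg
    exact ⟨M, fun i t ht => by rw [e i t ht]; exact hM i t ht⟩
  | succ n =>
    obtain ⟨c, k, hc, hk, hck⟩ := hg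
    exact ⟨c, k, hc, hk, fun i t ht => by rw [e i t ht]; exact hck i t ht⟩

lemma bounded (hg : IsJet n g) : ∃ M : ℝ, ∀ i t, |t| ≤ 1 → |g i t| ≤ M := by
  induction n generalizing g with
  | zero => exact hg
  | succ n ih =>
    obtain ⟨c, k, ⟨M, hM⟩, hk, hck⟩ := hg
    obtain ⟨N, hN⟩ := ih hk
    refine ⟨M + N, fun i t ht => ?_⟩
    rw [hck i t ht]
    have h1 := hM i
    have h2 := hN i t ht
    calc |c i + t * k i t| ≤ |c i| + |t| * |k i t| := by
          rw [← abs_mul]; exact abs_add_le _ _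
      _ ≤ M + 1 * N := by gcongr
      _ = M + N := by ring

lemma const {c : ι → ℝ} (n : ℕ) (hc : ∃ M : ℝ, ∀ i, |c i| ≤ M) : IsJet n fun i _ => c i := by
  induction n generalizing c with
  | zero => obtain ⟨M, hM⟩ := hc; exact ⟨M, fun i _ _ => hM i⟩
  | succ n ih =>
    exact ⟨c, fun _ _ => 0, hc, ih ⟨0, fun _ => by simp⟩, fun i t _ => by simp⟩

lemma const' (n : ℕ) (c : ℝ) : IsJet n fun (_ : ι) _ => c := const n ⟨|c|, fun _ => le_rfl⟩

lemma of_succ (hg : IsJet (n + 1) g) : IsJet n g := by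
  induction n generalizing g with
  | zero => exact hg.bounded
  | succ n ih =>
    obtain ⟨c, k, hc, hk, hck⟩ := hg
    exact ⟨c, k, hc, ih hk, hck⟩

lemma mono {m : ℕ} (hg : IsJet n g) (hmn : m ≤ n) : IsJet m g := by
  induction hmn with
  | refl => exact hg
  | step _ ih => exact ih hg.of_succ

lemma add (hg : IsJet n g) (hh : IsJet n h) : IsJet n fun i t => g i t + h i t := by
  induction n generalizing g h with
  | zero =>
    obtain ⟨M, hM⟩ := hg
    obtain ⟨N, hN⟩ := hh
    exact ⟨M + N, fun i t ht => (abs_add_le _ _).trans (add_le_add (hM i t ht) (hN i t ht))⟩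
  | succ n ih =>
    obtain ⟨c, k, ⟨M, hM⟩, hk, hck⟩ := hg
    obtain ⟨c', k', ⟨M', hM'⟩, hk', hck'⟩ := hh
    exact ⟨fun i => c i + c' i, fun i t => k i t + k' i t,
      ⟨M + M', fun i => (abs_add_le _ _).trans (add_le_add (hM i) (hM' i))⟩, ih hk hk',
      fun i t ht => by simp only [hck i t ht, hck' i t ht]; ring⟩

lemma mul (hg : IsJet n g) (hh : IsJet n h) : IsJet n fun i t => g i t * h i t := by
  induction n generalizing g h with
  | zero =>
    obtain ⟨M, hM⟩ := hg
    obtain ⟨N, hN⟩ := hh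
    refine ⟨M * N, fun i t ht => ?_⟩
    rw [abs_mul]
    have h1 := hM i t ht
    have h2 := hN i t ht
    have := abs_nonneg (g i t)
    gcongr
    linarith
  | succ n ih =>
    -- The product is `c c' + t (c k' + k h)`, so the full factor `h` is needed at the lower order.
    have hh' := hh.of_succ
    obtain ⟨c, k, ⟨M, hM⟩, hk, hck⟩ := hg
    obtain ⟨c', k', ⟨M', hM'⟩, hk', hck'⟩ := hh
    refine ⟨fun i => c i * c' i, fun i t => c i * k' i t + k i t * h i t,
      ⟨M * M', fun i => ?_⟩, (ih (const n ⟨M, hM⟩) hk').add (ih hk hh'), fun i t ht => ?_⟩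
    · rw [abs_mul]
      have h1 := hM i
      have := abs_nonneg (c i)
      exact mul_le_mul h1 (hM' i) (abs_nonneg _) (by linarith)
    · simp only []
      rw [hck i t ht, hck' i t ht]; ring

lemma neg (hg : IsJet n g) : IsJet n fun i t => -g i t :=
  ((const' n (-1)).mul hg).congr fun _ _ _ => by ring

/-- From `g = c + t k` follows `g⁻¹ = c⁻¹ - t c⁻¹ k g⁻¹`, so the inverse at order `n` yields the
inverse at order `n + 1`. -/
lemma inv (hg : IsJet n g) {ε : ℝ} (hε : 0 < ε) (h : ∀ i t, |t| ≤ 1 → ε ≤ |g i t|) :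
    IsJet n fun i t => (g i t)⁻¹ := by
  induction n with
  | zero =>
    refine ⟨ε⁻¹, fun i t ht => ?_⟩
    rw [abs_inv]
    exact inv_anti₀ hε (h i t ht)
  | succ n ih =>
    have hinv := ih hg.of_succ
    obtain ⟨c, k, ⟨M, hM⟩, hk, hck⟩ := hg
    have hc : ∀ i, ε ≤ |c i| := fun i => by
      have := h i 0 (by simp)
      rw [hck i 0 (by simp)] at this
      simpa using this
    have hb : ∃ M : ℝ, ∀ i, |(c i)⁻¹| ≤ M :=
      ⟨ε⁻¹, fun i => by rw [abs_inv]; exact inv_anti₀ hε (hc i)⟩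
    refine ⟨fun i => (c i)⁻¹, fun i t => -((c i)⁻¹ * (k i t * (g i t)⁻¹)), hb,
      ((const n hb).mul (hk.mul hinv)).neg, fun i t ht => ?_⟩
    have h1 : c i ≠ 0 := abs_pos.1 (hε.trans_le (hc i))
    have h2 : g i t ≠ 0 := abs_pos.1 (hε.trans_le (h i t ht))
    have h3 := hck i t ht
    field_simp
    linarith

lemma reparam {κ : Type} (hg : IsJet n g) (s : κ → ι) {c : κ → ℝ} (hc : ∀ i, |c i| ≤ 1) :
    IsJet n fun i t => g (s i) (c i * t) := by
  have hct : ∀ i (t : ℝ), |t| ≤ 1 → |c i * t| ≤ 1 := fun i t ht => by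
    rw [abs_mul]
    exact mul_le_one₀ (hc i) (abs_nonneg _) ht
  induction n generalizing g with
  | zero =>
    obtain ⟨M, hM⟩ := hg
    exact ⟨M, fun i t ht => hM _ _ (hct i t ht)⟩
  | succ n ih =>
    obtain ⟨d, k, ⟨M, hM⟩, hk, hck⟩ := hg
    exact ⟨fun i => d (s i), fun i t => c i * k (s i) (c i * t), ⟨M, fun i => hM _⟩,
      (const n ⟨1, hc⟩).mul (ih hk), fun i t ht => by
        simp only [hck _ _ (hct i t ht)]; ring⟩

lemma at_zero (hg : IsJet n g) (m : ℕ) : IsJet m fun i _ => g i 0 := by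
  obtain ⟨M, hM⟩ := hg.bounded
  exact const m ⟨M, fun i => hM i 0 (by simp)⟩

/-- The recursive definition suits products and inverses; this unrolled Taylor form, with its
converse `of_expansion`, suits rescaling and integration. -/
lemma exists_expansion (hg : IsJet n g) : ∃ (c : ℕ → ι → ℝ) (h : ι → ℝ → ℝ),
    (∀ k, ∃ M : ℝ, ∀ i, |c k i| ≤ M) ∧ IsJet 0 h ∧
    ∀ i t, |t| ≤ 1 → g i t = ∑ k ∈ Finset.range n, c k i * t ^ k + t ^ n * h i t := by
  induction n generalizing g with
  | zero => exact ⟨fun _ _ => 0, g, fun _ => ⟨0, fun _ => by simp⟩, hg, fun _ _ _ => by simp⟩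
  | succ n ih =>
    obtain ⟨d, k, hd, hk, hck⟩ := hg
    obtain ⟨c, h, hc, hh, e⟩ := ih hk
    refine ⟨fun j => Nat.casesOn j d c, h, fun j => ?_, hh, fun i t ht => ?_⟩
    · cases j with
      | zero => exact hd
      | succ j => exact hc j
    · have : ∑ k ∈ Finset.range n, c k i * t ^ (k + 1) =
          t * ∑ k ∈ Finset.range n, c k i * t ^ k := by
        rw [Finset.mul_sum]
        exact Finset.sum_congr rfl fun _ _ => by ring
      rw [hck i t ht, e i t ht, Finset.sum_range_succ']
      change _ = ∑ k ∈ Finset.range n, c k i * t ^ (k + 1) + d i * t ^ 0 + _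
      rw [this]
      ring

lemma of_expansion {c : ℕ → ι → ℝ} (hc : ∀ k < n, ∃ M : ℝ, ∀ i, |c k i| ≤ M) (hh : IsJet 0 h)
    (e : ∀ i t, |t| ≤ 1 → g i t = ∑ k ∈ Finset.range n, c k i * t ^ k + t ^ n * h i t) :
    IsJet n g := by
  induction n generalizing g c with
  | zero => exact hh.congr fun i t ht => by rw [e i t ht]; simp
  | succ n ih =>
    refine ⟨c 0, fun i t => ∑ k ∈ Finset.range n, c (k + 1) i * t ^ k + t ^ n * h i t,
      hc 0 (by lia), ih (c := fun k => c (k + 1)) (fun k hk => hc (k + 1) (by lia))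
      fun i t _ => rfl, fun i t ht => ?_⟩
    have : ∑ k ∈ Finset.range n, c (k + 1) i * t ^ (k + 1) =
        t * ∑ k ∈ Finset.range n, c (k + 1) i * t ^ k := by
      rw [Finset.mul_sum]
      exact Finset.sum_congr rfl fun _ _ => by ring
    rw [e i t ht, Finset.sum_range_succ', this]
    ring

end IsJet

/-- The values at the `n` nodes `j / n` determine the coefficients through the inverse Vandermonde
matrix; `K` is the sum of the absolute values of its entries. -/
lemma exists_coeff_le_of_bounded_on_Icc (n : ℕ) : ∃ K : ℝ, ∀ (c : ℕ → ℝ) (B : ℝ),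
    (∀ t : ℝ, |t| ≤ 1 → |∑ k ∈ Finset.range n, c k * t ^ k| ≤ B) → ∀ k < n, |c k| ≤ K * B := by
  let v : Fin n → ℝ := fun j => (j : ℝ) / n
  have hv : Function.Injective v := fun i j hij => by
    have hn : (n : ℝ) ≠ 0 := by
      have := i.pos
      positivity
    have : (i : ℝ) = j := by
      simpa [v, div_left_inj' hn] using hij
    exact Fin.ext (by exact_mod_cast this)
  have hdet : IsUnit (Matrix.vandermonde v).det :=
    (Matrix.det_vandermonde_ne_zero_iff.2 hv).isUnit
  let W := (Matrix.vandermonde v)⁻¹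
  refine ⟨∑ k, ∑ j, |W k j|, fun c B hB k hk => ?_⟩
  have hB0 : 0 ≤ B := (abs_nonneg _).trans (hB 0 (by simp))
  let c' : Fin n → ℝ := fun k => c k
  have h1 : W.mulVec ((Matrix.vandermonde v).mulVec c') = c' := by
    rw [Matrix.mulVec_mulVec, Matrix.nonsing_inv_mul _ hdet, Matrix.one_mulVec]
  have h2 : ∀ j, |(Matrix.vandermonde v).mulVec c' j| ≤ B := fun j => by
    have h3 : |v j| ≤ 1 := by
      have : (0 : ℝ) < n := by have := j.pos; positivity
      rw [abs_of_nonneg (by positivity), div_le_one this]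
      exact_mod_cast j.2.le
    have := hB (v j) h3
    rw [Finset.sum_range] at this
    have h5 : (Matrix.vandermonde v).mulVec c' j = ∑ k : Fin n, c k * v j ^ (k : ℕ) := by
      simp only [Matrix.mulVec, dotProduct, Matrix.vandermonde_apply, c']
      exact Finset.sum_congr rfl fun k _ => mul_comm (v j ^ (k : ℕ)) (c k)
    rw [h5]
    exact this
  have h4 : c k = ∑ j, W ⟨k, hk⟩ j * (Matrix.vandermonde v).mulVec c' j :=
    (congrFun h1 ⟨k, hk⟩).symm
  rw [h4]
  calc _ ≤ ∑ j, |W ⟨k, hk⟩ j| * B := by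
        refine (Finset.abs_sum_le_sum_abs _ _).trans (Finset.sum_le_sum fun j _ => ?_)
        rw [abs_mul]
        exact mul_le_mul_of_nonneg_left (h2 j) (abs_nonneg _)
    _ = (∑ j, |W ⟨k, hk⟩ j|) * B := by rw [Finset.sum_mul]
    _ ≤ _ := mul_le_mul_of_nonneg_right (Finset.single_le_sum
        (f := fun k => ∑ j, |W k j|) (fun _ _ => Finset.sum_nonneg fun _ _ => abs_nonneg _)
        (Finset.mem_univ _)) hB0

namespace IsJet

variable {ι : Type} {n : ℕ} {g h : ι → ℝ → ℝ}

/-- A bounded anisotropic rescaling of a family with uniform jets has uniform jets. -/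
lemma rescale (hg : IsJet n g) {j : ℕ} (hj : j ≤ n) {δ : ι → ℝ} {D κ : ℝ} (hδ : ∀ i, 0 < δ i)
    (hD : ∀ i, δ i ≤ D) (hκ : ∀ i, |κ * δ i| ≤ 1)
    (hb : IsJet 0 fun i t => (δ i)⁻¹ ^ j * g i (κ * δ i * t)) :
    IsJet n fun i t => (δ i)⁻¹ ^ j * g i (κ * δ i * t) := by
  obtain ⟨c, h, hc, ⟨N, hN⟩, e⟩ := hg.exists_expansion
  obtain ⟨B, hB⟩ := hb
  have hct : ∀ i (t : ℝ), |t| ≤ 1 → |κ * δ i * t| ≤ 1 := fun i t ht => by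
    rw [abs_mul]
    exact mul_le_one₀ (hκ i) (abs_nonneg _) ht
  let C : ℕ → ι → ℝ := fun k i => (δ i)⁻¹ ^ j * (c k i * (κ * δ i) ^ k)
  -- The remainder acquires the factor `δ⁻ʲ (κ δ)ⁿ = κⁿ δⁿ⁻ʲ`, which is bounded because `j ≤ n` and
  -- `δ ≤ D`.
  let H : ι → ℝ → ℝ := fun i t => κ ^ n * δ i ^ (n - j) * h i (κ * δ i * t)
  have hH : ∀ i t, |t| ≤ 1 → |H i t| ≤ |κ| ^ n * D ^ (n - j) * N := fun i t ht => by
    have h1 := hδ i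
    have h2 := hD i
    have h3 := hN i _ (hct i t ht)
    simp only [H]
    rw [abs_mul, abs_mul, abs_pow, abs_pow, abs_of_pos h1]
    have h4 : 0 ≤ D := h1.le.trans h2
    gcongr
  have key : ∀ i t, |t| ≤ 1 → (δ i)⁻¹ ^ j * g i (κ * δ i * t) =
      ∑ k ∈ Finset.range n, C k i * t ^ k + t ^ n * H i t := fun i t ht => by
    have h1 := (hδ i).ne'
    rw [e i _ (hct i t ht), mul_add, Finset.mul_sum]
    congr 1
    · exact Finset.sum_congr rfl fun _ _ => by simp only [C]; ring
    · simp only [H]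
      obtain ⟨d, rfl⟩ := Nat.exists_eq_add_of_le hj
      have h2 : (δ i)⁻¹ ^ j * δ i ^ j = 1 := by rw [← mul_pow, inv_mul_cancel₀ h1, one_pow]
      rw [Nat.add_sub_cancel_left, mul_pow, mul_pow, pow_add (δ i)]
      linear_combination κ ^ (j + d) * t ^ (j + d) * δ i ^ d * h i (κ * δ i * t) * h2
  -- For `k < j` the coefficient `C k` carries a negative power of `δ`. Its bound comes from the
  -- polynomial part as a whole, which is a bounded function minus a bounded remainder.
  obtain ⟨K, hK⟩ := exists_coeff_le_of_bounded_on_Icc n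
  refine of_expansion (c := C) (fun k hk => ⟨K * (B + |κ| ^ n * D ^ (n - j) * N), fun i =>
    hK (fun k => C k i) _ (fun t ht => ?_) k hk⟩) ⟨_, hH⟩ key
  have h1 : ∑ k ∈ Finset.range n, C k i * t ^ k =
      (δ i)⁻¹ ^ j * g i (κ * δ i * t) - t ^ n * H i t := by rw [key i t ht]; ring
  rw [h1]
  refine (abs_sub _ _).trans (add_le_add (hB i t ht) ?_)
  rw [abs_mul, abs_pow]
  calc _ ≤ 1 * (|κ| ^ n * D ^ (n - j) * N) :=
        mul_le_mul (pow_le_one₀ (abs_nonneg _) ht) (hH i t ht) (abs_nonneg _) zero_le_one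
    _ = _ := one_mul _

/-- Integration gains one order. Subtracting from `g` the primitive of the polynomial part of `g'`
leaves `G` with derivative `t ^ n * h`. No regularity of `h` in `t` is known, so the mean value
inequality replaces an integral. -/
lemma of_hasDerivAt {g' : ι → ℝ → ℝ} (h0 : ∃ M : ℝ, ∀ i, |g i 0| ≤ M)
    (hd : ∀ i t, |t| ≤ 1 → HasDerivAt (g i) (g' i t) t) (hg' : IsJet n g') : IsJet (n + 1) g := by
  obtain ⟨c, h, hc, ⟨N, hN⟩, e⟩ := hg'.exists_expansion
  let C : ℕ → ι → ℝ := fun k => Nat.casesOn k (fun i => g i 0) fun k i => c k i / (k + 1)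
  let G : ι → ℝ → ℝ := fun i t => g i t - ∑ k ∈ Finset.range n, c k i / (k + 1) * t ^ (k + 1)
  have hG : ∀ i t, |t| ≤ 1 → HasDerivAt (G i) (t ^ n * h i t) t := fun i t ht => by
    have h1 : HasDerivAt (fun t : ℝ => ∑ k ∈ Finset.range n, c k i / (k + 1) * t ^ (k + 1))
        (∑ k ∈ Finset.range n, c k i * t ^ k) t := by
      refine HasDerivAt.fun_sum fun k _ => ?_
      have := (hasDerivAt_pow (k + 1) t).const_mul (c k i / ((k : ℝ) + 1))
      refine this.congr_deriv ?_
      have : (k : ℝ) + 1 ≠ 0 := by positivity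
      push_cast
      field_simp
    refine ((hd i t ht).fun_sub h1).congr_deriv ?_
    rw [e i t ht]; ring
  have hG' : ∀ i t, |t| ≤ 1 → |G i t - G i 0| ≤ N * |t| ^ (n + 1) := fun i t ht => by
    have hsub : ∀ s ∈ Set.uIcc 0 t, |s| ≤ |t| := fun s hs => by
      rcases le_total 0 t with h0 | h0
      · rw [Set.uIcc_of_le h0] at hs
        rw [abs_of_nonneg hs.1, abs_of_nonneg h0]; exact hs.2
      · rw [Set.uIcc_of_ge h0] at hs
        rw [abs_of_nonpos hs.2, abs_of_nonpos h0]; linarith [hs.1]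
    have := (convex_uIcc (0 : ℝ) t).norm_image_sub_le_of_norm_hasDerivWithin_le (f := G i)
      (f' := fun t => t ^ n * h i t) (C := |t| ^ n * N) (x := 0) (y := t)
      (fun s hs => (hG i s ((hsub s hs).trans ht)).hasDerivWithinAt)
      (fun s hs => by
        rw [Real.norm_eq_abs, abs_mul, abs_pow]
        have h1 := hN i s ((hsub s hs).trans ht)
        have h2 := hsub s hs
        gcongr) Set.left_mem_uIcc Set.right_mem_uIcc
    rw [Real.norm_eq_abs, Real.norm_eq_abs, sub_zero] at this
    refine this.trans (le_of_eq ?_)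
    ring
  have hG0 : ∀ i, G i 0 = g i 0 := fun i => by simp [G]
  -- At `t = 0` the quotient takes the value `0`; this is harmless, as the expansion multiplies it
  -- by `t ^ (n + 1)`.
  refine of_expansion (c := C) (h := fun i t => (G i t - G i 0) / t ^ (n + 1))
    (fun k hk => ?_) ⟨|N|, fun i t ht => ?_⟩ fun i t ht => ?_
  · cases k with
    | zero => exact h0
    | succ k =>
      obtain ⟨M, hM⟩ := hc k
      refine ⟨M, fun i => ?_⟩
      simp only [C]
      rw [abs_div, abs_of_nonneg (by positivity : (0 : ℝ) ≤ (k : ℝ) + 1)]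
      exact (div_le_self (abs_nonneg _) (by linarith [k.cast_nonneg (α := ℝ)])).trans (hM i)
  · rcases eq_or_ne t 0 with rfl | ht0
    · simp
    · rw [abs_div, abs_pow, div_le_iff₀ (by positivity)]
      exact (hG' i t ht).trans (mul_le_mul_of_nonneg_right (le_abs_self _) (by positivity))
  · rcases eq_or_ne t 0 with rfl | ht0
    · simp [Finset.sum_range_succ', C]
    · rw [mul_div_cancel₀ _ (pow_ne_zero _ ht0), Finset.sum_range_succ', hG0]
      simp [C, G]

lemma of_lipschitz {M L : ℝ} (h0 : ∀ i, |g i 0| ≤ M)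
    (hL : ∀ i t, |t| ≤ 1 → |g i t - g i 0| ≤ L * |t|) : IsJet 1 g := by
  refine ⟨fun i => g i 0, fun i t => (g i t - g i 0) / t, ⟨M, h0⟩, ⟨|L|, fun i t ht => ?_⟩,
    fun i t ht => ?_⟩
  · rcases eq_or_ne t 0 with rfl | ht0
    · simp
    · rw [abs_div, div_le_iff₀ (by positivity)]
      exact (hL i t ht).trans (mul_le_mul_of_nonneg_right (le_abs_self _) (by positivity))
  · rcases eq_or_ne t 0 with rfl | ht0
    · simp
    · rw [mul_div_cancel₀ _ ht0]; ring

lemma lipschitz (hg : IsJet n g) (hn : 1 ≤ n) :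
    ∃ L : ℝ, 0 ≤ L ∧ ∀ i t, |t| ≤ 1 → |g i t - g i 0| ≤ L * |t| := by
  obtain ⟨c, h, hc, ⟨M, hM⟩, e⟩ := hg.mono hn
  refine ⟨|M|, abs_nonneg _, fun i t ht => ?_⟩
  rw [e i t ht, e i 0 (by simp), zero_mul, add_zero, add_sub_cancel_left, abs_mul, mul_comm]
  exact mul_le_mul_of_nonneg_right ((hM i t ht).trans (le_abs_self _)) (abs_nonneg _)

end IsJet

/-! ### The ring of jets -/

/-- The ring of families with uniform jets of order `n`. -/
def jetRing (ι : Type) (n : ℕ) : Subring (ι → ℝ → ℝ) where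
  carrier := {g | IsJet n g}
  mul_mem' := fun h1 h2 => h1.mul h2
  one_mem' := IsJet.const' n 1
  add_mem' := fun h1 h2 => h1.add h2
  zero_mem' := IsJet.const' n 0
  neg_mem' := fun h => h.neg

lemma mem_jetRing {ι : Type} {n : ℕ} {g : ι → ℝ → ℝ} : g ∈ jetRing ι n ↔ IsJet n g := Iff.rfl

/-- Evaluation of a family at an index and a time. -/
def jetEval {ι : Type} (n : ℕ) (i : ι) (t : ℝ) : jetRing ι n →+* ℝ :=
  ((Pi.evalRingHom (fun _ : ℝ => ℝ) t).comp (Pi.evalRingHom (fun _ : ι => ℝ → ℝ) i)).comp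
    (jetRing ι n).subtype

lemma jetEval_apply {ι : Type} (n : ℕ) (i : ι) (t : ℝ) (g : jetRing ι n) :
    jetEval n i t g = (g : ι → ℝ → ℝ) i t := rfl

/-! ### Real-rooted polynomials: bounds for the roots and their continuity -/

/-- A monic real polynomial whose complex roots are real splits over `ℝ`. -/
lemma IsHyperbolic.splits {p : ℝ[X]} (hp : IsHyperbolic p) : p.Splits := by
  by_cases h0 : p = 0
  · rw [h0]; exact Splits.zero
  refine Splits.of_splits_map Complex.ofRealHom (IsAlgClosed.splits _) fun z hz => ?_
  have hz' : aeval z p = 0 := by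
    have := (mem_roots'.1 hz).2
    rw [IsRoot.def, eval_map] at this
    exact this
  exact ⟨z.re, Complex.ext (by simp) (by simp [hp z hz'])⟩

section monicPoly

variable {n : ℕ} (a : Fin n → ℝ)

lemma coeff_monicPoly (k : ℕ) : (monicPoly a).coeff k =
    if h : k < n then a ⟨n - 1 - k, by lia⟩ else if k = n then 1 else 0 := by
  have hs : (∑ j : Fin n, C (a j) * X ^ (n - (j.val + 1))).coeff k =
      if h : k < n then a ⟨n - 1 - k, by lia⟩ else 0 := by
    rw [finsetSum_coeff]
    simp only [coeff_C_mul_X_pow]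
    split_ifs with h
    · rw [Finset.sum_eq_single (⟨n - 1 - k, by lia⟩ : Fin n)]
      · rw [if_pos (by simp only []; lia)]
      · intro j _ hj
        rw [if_neg]
        intro hk
        apply hj
        ext
        simp only []
        have := j.2
        lia
      · simp
    · refine Finset.sum_eq_zero fun j _ => ?_
      rw [if_neg]
      have := j.2
      lia
  rw [monicPoly, coeff_add, hs, coeff_X_pow]
  split_ifs <;> first | lia | simp

lemma natDegree_monicPoly : (monicPoly a).natDegree = n := by
  refine natDegree_eq_of_le_of_coeff_ne_zero ?_ ?_
  · refine natDegree_le_iff_coeff_eq_zero.2 fun k hk => ?_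
    rw [coeff_monicPoly, dif_neg (by lia), if_neg (by lia)]
  · simp [coeff_monicPoly]

lemma monic_monicPoly : (monicPoly a).Monic := by
  rw [Monic, leadingCoeff, natDegree_monicPoly, coeff_monicPoly]
  simp

end monicPoly

namespace Polynomial

variable {p : ℝ[X]}

/-- Newton's identity `e₁² = p₂ + 2 e₂` with `e₁ = 0`. Through it a single coefficient controls all
the roots of a centered polynomial. -/
lemma Splits.sum_sq_roots (hp : p.Splits) (hm : p.Monic) (h2 : 2 ≤ p.natDegree)
    (h1 : p.coeff (p.natDegree - 1) = 0) :
    (p.roots.map fun x => x ^ 2).sum = -2 * p.coeff (p.natDegree - 2) := by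
  have hcard := hp.natDegree_eq_card_roots
  have e1 := coeff_eq_esymm_roots_of_card hcard.symm (k := p.natDegree - 1) (by lia)
  have e2 := coeff_eq_esymm_roots_of_card hcard.symm (k := p.natDegree - 2) (by lia)
  rw [show p.natDegree - (p.natDegree - 1) = 1 by lia, h1, hm.leadingCoeff] at e1
  rw [show p.natDegree - (p.natDegree - 2) = 2 by lia, hm.leadingCoeff] at e2
  have key : ∀ s : Multiset ℝ, s.esymm 1 = s.sum ∧
      s.sum ^ 2 = (s.map fun x => x ^ 2).sum + 2 * s.esymm 2 := fun s => by
    induction s using Multiset.induction with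
    | empty => simp [Multiset.esymm, Multiset.powersetCard_zero_right]
    | cons a s ih =>
      obtain ⟨i1, i2⟩ := ih
      have j1 : (a ::ₘ s).esymm 1 = a + s.esymm 1 := by
        simp [Multiset.esymm, Multiset.powersetCard_one, add_comm]
      have j2 : (a ::ₘ s).esymm 2 = s.esymm 2 + a * s.esymm 1 := by
        simp [Multiset.esymm, Multiset.powersetCard_cons, Multiset.sum_map_mul_left]
      refine ⟨by rw [j1, i1, Multiset.sum_cons], ?_⟩
      rw [j2, i1, Multiset.sum_cons, Multiset.map_cons, Multiset.sum_cons]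
      linear_combination i2
  obtain ⟨k1, k2⟩ := key p.roots
  rw [k1] at e1
  have e3 : p.roots.sum = 0 := by linarith
  rw [e3] at k2
  linarith

lemma Splits.sq_le_of_mem_roots (hp : p.Splits) (hm : p.Monic) (h2 : 2 ≤ p.natDegree)
    (h1 : p.coeff (p.natDegree - 1) = 0) {x : ℝ} (hx : x ∈ p.roots) :
    x ^ 2 ≤ -2 * p.coeff (p.natDegree - 2) := by
  rw [← hp.sum_sq_roots hm h2 h1]
  exact Multiset.single_le_sum (s := p.roots.map fun x => x ^ 2)
    (fun y hy => by
      obtain ⟨z, _, rfl⟩ := Multiset.mem_map.1 hy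
      positivity) _ (Multiset.mem_map_of_mem _ hx)

lemma Splits.abs_coeff_le (hp : p.Splits) (hm : p.Monic) {B : ℝ}
    (hB : ∀ x ∈ p.roots, |x| ≤ B) (k : ℕ) :
    |p.coeff k| ≤ B ^ (p.natDegree - k) * p.natDegree.choose k := by
  have := coeff_le_of_roots_le (f := RingHom.id ℝ) k hm (by simpa using hp)
    (by simpa using hB)
  simpa using this

/-- A root of a monic polynomial with coefficients bounded by `B` is bounded in terms of `B` and the
degree. -/
lemma Monic.abs_le_of_isRoot (hm : p.Monic) {B : ℝ} (hB : ∀ k < p.natDegree, |p.coeff k| ≤ B)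
    {x : ℝ} (hx : p.IsRoot x) : |x| ≤ 1 + p.natDegree * B := by
  by_contra! hlt
  have hn : 0 < p.natDegree := by
    rw [Nat.pos_iff_ne_zero]
    intro h0
    rw [hm.natDegree_eq_zero.1 h0] at hx
    simp at hx
  have hB0 : 0 ≤ B := (abs_nonneg _).trans (hB 0 hn)
  have hx1 : 1 ≤ |x| := le_trans (by nlinarith [p.natDegree.cast_nonneg (α := ℝ)]) hlt.le
  rw [IsRoot.def, eval_eq_sum_range, Finset.sum_range_succ, hm.coeff_natDegree, one_mul] at hx
  have h1 : |x| ^ p.natDegree ≤ p.natDegree * B * |x| ^ (p.natDegree - 1) := by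
    rw [← abs_pow, show x ^ p.natDegree = -∑ k ∈ Finset.range p.natDegree, p.coeff k * x ^ k by
      linarith, abs_neg]
    refine (Finset.abs_sum_le_sum_abs _ _).trans ?_
    calc _ ≤ ∑ k ∈ Finset.range p.natDegree, B * |x| ^ (p.natDegree - 1) := by
          refine Finset.sum_le_sum fun k hk => ?_
          rw [Finset.mem_range] at hk
          rw [abs_mul, abs_pow]
          have := hB k hk
          gcongr
          lia
      _ = _ := by simp; ring
  obtain ⟨m, hm⟩ : ∃ m, p.natDegree = m + 1 := ⟨p.natDegree - 1, by lia⟩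
  rw [show p.natDegree - 1 = m by lia] at h1
  rw [show |x| ^ p.natDegree = |x| * |x| ^ m by rw [hm]; ring] at h1
  have := le_of_mul_le_mul_right h1 (by positivity)
  linarith

lemma abs_eval_le_of_abs_coeff_le {n : ℕ} (hp : p.natDegree ≤ n) {B η x : ℝ} (hB : 1 ≤ B)
    (hx : |x| ≤ B) (hη : ∀ k, |p.coeff k| ≤ η) : |p.eval x| ≤ (n + 1) * B ^ n * η := by
  have hη0 : 0 ≤ η := (abs_nonneg _).trans (hη 0)
  rw [eval_eq_sum_range' (Nat.lt_succ_of_le hp)]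
  refine (Finset.abs_sum_le_sum_abs _ _).trans ?_
  calc _ ≤ ∑ k ∈ Finset.range (n + 1), η * B ^ n := by
        refine Finset.sum_le_sum fun k hk => ?_
        rw [Finset.mem_range] at hk
        rw [abs_mul, abs_pow]
        have := hη k
        have h2 : |x| ^ k ≤ B ^ n := by
          calc |x| ^ k ≤ B ^ k := by gcongr
            _ ≤ B ^ n := by gcongr; lia
        gcongr
    _ = _ := by simp; ring

/-- The value `|p.eval x|` is the product of the distances from `x` to the roots, which exceeds `ε ^
natDegree` if every factor exceeds `ε`. -/
lemma Splits.exists_mem_roots_abs_sub_le (hp : p.Splits) (hm : p.Monic) (hd : 0 < p.natDegree)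
    {x ε : ℝ} (hε : 0 ≤ ε) (h : |p.eval x| ≤ ε ^ p.natDegree) : ∃ y ∈ p.roots, |x - y| ≤ ε := by
  by_contra! hlt
  have key : ∀ s : Multiset ℝ, (∀ y ∈ s, ε < |x - y|) →
      ε ^ s.card ≤ |(s.map fun y => x - y).prod| ∧
      (0 < s.card → ε ^ s.card < |(s.map fun y => x - y).prod|) := fun s => by
    induction s using Multiset.induction with
    | empty => simp
    | cons a s ih =>
      intro hs
      have h1 := (ih fun y hy => hs y (Multiset.mem_cons_of_mem hy)).1
      have h2 := hs a (Multiset.mem_cons_self _ _)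
      have h3 : ε ^ (a ::ₘ s).card < |((a ::ₘ s).map fun y => x - y).prod| := by
        rw [Multiset.card_cons, Multiset.map_cons, Multiset.prod_cons, abs_mul, pow_succ']
        -- For `ε = 0` strictness does not follow by multiplying the bounds; it needs that no factor
        -- vanishes.
        rcases hε.eq_or_lt with rfl | hε'
        · have h4 : (s.map fun y => x - y).prod ≠ 0 := by
            rw [Ne, Multiset.prod_eq_zero_iff]
            intro h0
            obtain ⟨y, hy, hy0⟩ := Multiset.mem_map.1 h0
            have := hs y (Multiset.mem_cons_of_mem hy)
            rw [hy0] at this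
            simp at this
          rw [zero_mul]
          positivity
        · calc ε * ε ^ s.card < |x - a| * ε ^ s.card := by gcongr
            _ ≤ _ := by gcongr
      exact ⟨h3.le, fun _ => h3⟩
  have := (key p.roots hlt).2 (by rw [← hp.natDegree_eq_card_roots]; exact hd)
  rw [← hp.natDegree_eq_card_roots, ← hp.eval_eq_prod_roots_of_monic hm] at this
  linarith

/-- If the difference of two polynomials is small, so is the difference of their quotients by the
linear factors of nearby roots. -/
lemma abs_coeff_sub_le_of_mul {n : ℕ} {p q p₁ q₁ : ℝ[X]} {x y B η ν : ℝ}
    (hp : p = (X - C x) * p₁) (hq : q = (X - C y) * q₁) (hp₁ : p₁.natDegree ≤ n)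
    (hq₁ : q₁.natDegree ≤ n) (hB : 1 ≤ B) (hx : |x| ≤ B) (hq₁B : ∀ k, |q₁.coeff k| ≤ B)
    (hη : ∀ k, |p.coeff k - q.coeff k| ≤ η) (hν : |x - y| ≤ ν) (k : ℕ) :
    |p₁.coeff k - q₁.coeff k| ≤ (n + 1) * B ^ (n + 1) * (η + ν) := by
  have hη0 : 0 ≤ η := (abs_nonneg _).trans (hη 0)
  have hν0 : 0 ≤ ν := (abs_nonneg _).trans hν
  have hrec : ∀ k, p₁.coeff k - q₁.coeff k = (p.coeff (k + 1) - q.coeff (k + 1)) +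
      x * (p₁.coeff (k + 1) - q₁.coeff (k + 1)) + (x - y) * q₁.coeff (k + 1) := fun k => by
    rw [hp, hq]
    simp only [sub_mul, coeff_sub, coeff_X_mul, coeff_C_mul]
    ring
  -- Synthetic division read from the top: `j` bounds the distance of `k` below `n`, and both
  -- quotients have no coefficients above `n`.
  have key : ∀ j k, n ≤ k + j → |p₁.coeff k - q₁.coeff k| ≤ (j + 1) * B ^ (j + 1) * (η + ν) := by
    intro j
    induction j with
    | zero =>
      intro k hk
      rw [hrec]
      rw [coeff_eq_zero_of_natDegree_lt (by lia : p₁.natDegree < k + 1),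
        coeff_eq_zero_of_natDegree_lt (by lia : q₁.natDegree < k + 1)]
      simp only [sub_zero, mul_zero, add_zero]
      refine (hη _).trans ?_
      have : η ≤ B * η := le_mul_of_one_le_left hη0 hB
      have : 0 ≤ B * ν := by positivity
      push_cast
      linarith
    | succ j ih =>
      intro k hk
      rw [hrec]
      have h1 := ih (k + 1) (by lia)
      have h2 := hη (k + 1)
      have h3 := hq₁B (k + 1)
      have h4 : |x * (p₁.coeff (k + 1) - q₁.coeff (k + 1))| ≤
          B * ((j + 1) * B ^ (j + 1) * (η + ν)) := by
        rw [abs_mul]; gcongr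
      have h5 : |(x - y) * q₁.coeff (k + 1)| ≤ ν * B := by
        rw [abs_mul]; gcongr
      have h6 : B ≤ B ^ (j + 2) := le_self_pow₀ hB (by lia)
      have h7 : η ≤ B * η := le_mul_of_one_le_left hη0 hB
      calc _ ≤ η + B * ((j + 1) * B ^ (j + 1) * (η + ν)) + ν * B := by
            refine (abs_add_le _ _).trans (add_le_add ((abs_add_le _ _).trans ?_) h5)
            exact add_le_add h2 h4
        _ ≤ B * (η + ν) + B * ((j + 1) * B ^ (j + 1) * (η + ν)) := by linarith
        _ ≤ B ^ (j + 2) * (η + ν) + B * ((j + 1) * B ^ (j + 1) * (η + ν)) := by gcongr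
        _ = _ := by push_cast; ring
  exact key n k (by lia)

/-- Continuity of the roots of real-rooted polynomials: monic polynomials with bounded coefficients
that are close have roots that can be matched up to a small error. -/
lemma exists_rel_roots (n : ℕ) {B ε : ℝ} (hε : 0 < ε) : ∃ η > 0, ∀ p q : ℝ[X], p.Monic → q.Monic →
    p.natDegree = n → q.natDegree = n → p.Splits → q.Splits →
    (∀ k < n, |p.coeff k| ≤ B) → (∀ k < n, |q.coeff k| ≤ B) →
    (∀ k < n, |p.coeff k - q.coeff k| ≤ η) →
    Multiset.Rel (fun x y => |x - y| ≤ ε) p.roots q.roots := by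
  induction n generalizing B ε with
  | zero =>
    refine ⟨1, one_pos, fun p q hp hq dp dq _ _ _ _ _ => ?_⟩
    rw [hp.natDegree_eq_zero.1 dp, hq.natDegree_eq_zero.1 dq]
    simp
  | succ n ih =>
    let R : ℝ := 1 + (n + 1) * |B|
    have hR : 1 ≤ R := by
      have : 0 ≤ (n + 1) * |B| := by positivity
      linarith
    let B₁ : ℝ := R ^ n * 2 ^ n
    have hRn : 1 ≤ R ^ n := one_le_pow₀ hR
    have h2n : (1 : ℝ) ≤ 2 ^ n := one_le_pow₀ (by norm_num)
    have hB₁ : 1 ≤ B₁ := one_le_mul_of_one_le_of_one_le hRn h2n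
    obtain ⟨η₁, hη₁, H⟩ := ih (B := B₁) hε
    let B₂ : ℝ := max R B₁
    have hB₂ : 1 ≤ B₂ := hR.trans (le_max_left _ _)
    let M : ℝ := (n + 1) * B₂ ^ (n + 1)
    have hM : 0 < M := by positivity
    -- A root `x` of `p` and a root `y` of `q` within `ν` are split off, and the induction continues
    -- with the quotients. These differ by at most `M * (η + ν)`, which the choices of `ν` and `η`
    -- keep below `η₁`.
    let ν : ℝ := min ε (η₁ / (2 * M))
    have hν : 0 < ν := lt_min hε (by positivity)
    let M' : ℝ := (n + 2) * R ^ (n + 1)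
    have hM' : 0 < M' := by positivity
    -- The second term forces `|q.eval x| ≤ ν ^ (n + 1)`, so that `q` has a root within `ν` of `x`.
    let η : ℝ := min (η₁ / (2 * M)) (ν ^ (n + 1) / M')
    refine ⟨η, lt_min (by positivity) (by positivity),
      fun p q hp hq dp dq sp sq bp bq bpq => ?_⟩
    have hη0 : 0 < η := lt_min (by positivity) (by positivity)
    have bpq' : ∀ k, |p.coeff k - q.coeff k| ≤ η := fun k => by
      rcases lt_trichotomy k (n + 1) with h | h | h
      · exact bpq k h
      · have h1 := hp.coeff_natDegree
        have h2 := hq.coeff_natDegree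
        rw [dp] at h1
        rw [dq] at h2
        rw [h, h1, h2]
        simpa using hη0.le
      · rw [coeff_eq_zero_of_natDegree_lt (by lia), coeff_eq_zero_of_natDegree_lt (by lia)]
        simpa using hη0.le
    have rootp : ∀ x ∈ p.roots, |x| ≤ R := fun x hx => by
      have := hp.abs_le_of_isRoot (B := |B|)
        (fun k hk => (bp k (by lia)).trans (le_abs_self _)) (mem_roots'.1 hx).2
      rw [dp] at this
      simpa [R] using this
    have rootq : ∀ x ∈ q.roots, |x| ≤ R := fun x hx => by
      have := hq.abs_le_of_isRoot (B := |B|)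
        (fun k hk => (bq k (by lia)).trans (le_abs_self _)) (mem_roots'.1 hx).2
      rw [dq] at this
      simpa [R] using this
    obtain ⟨x, hx⟩ : ∃ x, x ∈ p.roots := by
      apply Multiset.card_pos_iff_exists_mem.1
      rw [← sp.natDegree_eq_card_roots]
      lia
    have hxp : p.eval x = 0 := (mem_roots'.1 hx).2
    obtain ⟨y, hy, hxy⟩ : ∃ y ∈ q.roots, |x - y| ≤ ν := by
      refine sq.exists_mem_roots_abs_sub_le hq (by lia) hν.le ?_
      have h1 : q.eval x = (q - p).eval x := by rw [eval_sub, hxp, sub_zero]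
      rw [h1, dq]
      have h2 := abs_eval_le_of_abs_coeff_le (p := q - p) (n := n + 1) (η := η)
        ((natDegree_sub_le _ _).trans (by simp [dp, dq])) hR (rootp x hx)
        (fun k => by rw [coeff_sub, abs_sub_comm]; exact bpq' k)
      refine h2.trans ?_
      have h3 : η ≤ ν ^ (n + 1) / M' := min_le_right _ _
      rw [le_div_iff₀ hM'] at h3
      refine le_trans (le_of_eq ?_) h3
      simp only [M']
      push_cast
      ring
    obtain ⟨p₁, hp₁⟩ := dvd_iff_isRoot.2 (mem_roots'.1 hx).2
    obtain ⟨q₁, hq₁⟩ := dvd_iff_isRoot.2 (mem_roots'.1 hy).2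
    have mp₁ : p₁.Monic := (monic_X_sub_C x).of_mul_monic_left (hp₁ ▸ hp)
    have mq₁ : q₁.Monic := (monic_X_sub_C y).of_mul_monic_left (hq₁ ▸ hq)
    have dp₁ : p₁.natDegree = n := by
      have := (monic_X_sub_C x).natDegree_mul mp₁
      rw [← hp₁, natDegree_X_sub_C] at this
      lia
    have dq₁ : q₁.natDegree = n := by
      have := (monic_X_sub_C y).natDegree_mul mq₁
      rw [← hq₁, natDegree_X_sub_C] at this
      lia
    have sp₁ : p₁.Splits := sp.of_dvd hp.ne_zero ⟨_, by rw [mul_comm]; exact hp₁⟩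
    have sq₁ : q₁.Splits := sq.of_dvd hq.ne_zero ⟨_, by rw [mul_comm]; exact hq₁⟩
    have rp : p.roots = x ::ₘ p₁.roots := by
      have h0 : (X - C x) * p₁ ≠ 0 := hp₁ ▸ hp.ne_zero
      rw [hp₁, roots_mul h0, roots_X_sub_C, Multiset.singleton_add]
    have rq : q.roots = y ::ₘ q₁.roots := by
      have h0 : (X - C y) * q₁ ≠ 0 := hq₁ ▸ hq.ne_zero
      rw [hq₁, roots_mul h0, roots_X_sub_C, Multiset.singleton_add]
    have cb : ∀ f : ℝ[X], f.Monic → f.Splits → f.natDegree = n → (∀ x ∈ f.roots, |x| ≤ R) →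
        ∀ k, |f.coeff k| ≤ B₁ := fun f hf sf df hr k => by
      refine (sf.abs_coeff_le hf hr k).trans ?_
      rw [df]
      have h1 : (n.choose k : ℝ) ≤ 2 ^ n := by exact_mod_cast Nat.choose_le_two_pow n k
      have h2 : R ^ (n - k) ≤ R ^ n := pow_le_pow_right₀ hR (by lia)
      exact mul_le_mul h2 h1 (by positivity) (by positivity)
    have cp₁ := cb p₁ mp₁ sp₁ dp₁ fun z hz => rootp z (by rw [rp]; exact Multiset.mem_cons_of_mem hz)
    have cq₁ := cb q₁ mq₁ sq₁ dq₁ fun z hz => rootq z (by rw [rq]; exact Multiset.mem_cons_of_mem hz)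
    rw [rp, rq]
    refine Multiset.Rel.cons (hxy.trans (min_le_left _ _)) ?_
    refine H p₁ q₁ mp₁ mq₁ dp₁ dq₁ sp₁ sq₁ (fun k _ => cp₁ k) (fun k _ => cq₁ k) fun k _ => ?_
    refine (abs_coeff_sub_le_of_mul hp₁ hq₁ dp₁.le dq₁.le hB₂ ((rootp x hx).trans (le_max_left _ _))
      (fun k => (cq₁ k).trans (le_max_right _ _)) bpq' hxy k).trans ?_
    have h1 : η ≤ η₁ / (2 * M) := min_le_left _ _
    have h2 : ν ≤ η₁ / (2 * M) := min_le_right _ _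
    calc M * (η + ν) ≤ M * (η₁ / (2 * M) + η₁ / (2 * M)) := by gcongr
      _ = η₁ := by field_simp; ring

end Polynomial

/-! ### Factors with separated roots inherit jets -/

section splitting

variable {ι : Type}

lemma pow_card_le_abs_prod {ε : ℝ} (hε : 0 ≤ ε) (s : Multiset ℝ) (h : ∀ x ∈ s, ε ≤ |x|) :
    ε ^ s.card ≤ |s.prod| := by
  induction s using Multiset.induction with
  | empty => simp
  | cons a s ih =>
    rw [Multiset.card_cons, Multiset.prod_cons, abs_mul, pow_succ']
    exact mul_le_mul (h a (Multiset.mem_cons_self _ _))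
      (ih fun x hx => h x (Multiset.mem_cons_of_mem hx)) (by positivity) (abs_nonneg _)

/-- A family of polynomials of bounded degree whose coefficients have uniform jets is a polynomial
over the ring of families with uniform jets. -/
lemma exists_jetRing_polynomial {k N : ℕ} {f : ι → ℝ → ℝ[X]} (hf : ∀ i t, (f i t).natDegree ≤ N)
    (hj : ∀ j, IsJet k fun i t => (f i t).coeff j) : ∃ F : (jetRing ι k)[X], F.natDegree ≤ N ∧
      (∀ j, (F.coeff j : ι → ℝ → ℝ) = fun i t => (f i t).coeff j) ∧
      ∀ i t, F.map (jetEval k i t) = f i t := by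
  let F : (jetRing ι k)[X] := ∑ j ∈ Finset.range (N + 1), monomial j ⟨_, hj j⟩
  have hF : ∀ j, F.coeff j = ⟨_, hj j⟩ := fun j => by
    simp only [F, finsetSum_coeff, coeff_monomial]
    by_cases h : j < N + 1
    · rw [Finset.sum_eq_single j (fun b _ hb => if_neg hb)
        (fun h' => absurd (Finset.mem_range.2 h) h'), if_pos rfl]
    · rw [Finset.sum_eq_zero fun b hb => if_neg fun hbj : b = j => h (hbj ▸ Finset.mem_range.1 hb)]
      apply Subtype.ext
      funext i t
      exact (coeff_eq_zero_of_natDegree_lt (by have := hf i t; lia)).symm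
  refine ⟨F, ?_, fun j => by rw [hF], fun i t => ?_⟩
  · refine natDegree_sum_le_of_forall_le _ _ fun j hj => (natDegree_monomial_le _).trans ?_
    have := Finset.mem_range.1 hj
    lia
  · ext j
    rw [coeff_map, hF]
    rfl

/-- Write `p_t - p_0 = t H` with `H` of order `k`. Separation of the roots makes the resultant of
`q_0` and `r_t` a unit of the jet ring, so `a q_0 + b r_t = 1` for some `a`, `b` over that ring.
Since `p_t - p_0 = (q_t - q_0) r_t + q_0 (r_t - r_0)`, multiplying by `b` and reducing modulo `q_0`
gives `q_t - q_0 = t (b H mod q_0)`, the left side having lower degree than `q_0`. The factor `t` is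
the order gained. -/
lemma isJet_succ_coeff_of_mul {d e k : ℕ} {p q r : ι → ℝ → ℝ[X]} (mq : ∀ i t, (q i t).Monic)
    (mr : ∀ i t, (r i t).Monic) (dq : ∀ i t, (q i t).natDegree = d)
    (dr : ∀ i t, (r i t).natDegree = e) (sq : ∀ i t, (q i t).Splits) (sr : ∀ i t, (r i t).Splits)
    (hpqr : ∀ i t, p i t = q i t * r i t) (hp : ∀ j, IsJet (k + 1) fun i t => (p i t).coeff j)
    (hq : ∀ j, IsJet k fun i t => (q i t).coeff j) (hr : ∀ j, IsJet k fun i t => (r i t).coeff j)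
    {ε : ℝ} (hε : 0 < ε)
    (sep : ∀ i s t, ∀ x ∈ (q i s).roots, ∀ y ∈ (r i t).roots, ε ≤ |x - y|) (j : ℕ) :
    IsJet (k + 1) fun i t => (q i t).coeff j := by
  -- Over an empty index type the jet ring is trivial, and degrees over it carry no information.
  rcases isEmpty_or_nonempty ι with hι | hι
  · exact ⟨fun i => 0, fun i _ => 0, ⟨0, fun i => by simp⟩, IsJet.const' k 0,
      fun i => (hι.false i).elim⟩
  obtain ⟨Q, dQ, cQ, eQ⟩ := exists_jetRing_polynomial (k := k) (f := fun i _ => q i 0)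
    (fun i _ => (dq i 0).le) fun j => (hq j).at_zero k
  obtain ⟨R, dR, cR, eR⟩ := exists_jetRing_polynomial (fun i t => (dr i t).le) hr
  choose c h hc hh e1 using hp
  obtain ⟨H, -, -, eH⟩ := exists_jetRing_polynomial (k := k) (N := d + e)
    (f := fun i t => ∑ j ∈ Finset.range (d + e + 1), monomial j (h j i t))
    (fun i t => natDegree_sum_le_of_forall_le _ _ fun j hj => (natDegree_monomial_le _).trans (by
      have := Finset.mem_range.1 hj
      lia)) (fun j => by
      simp only [finsetSum_coeff, coeff_monomial]
      by_cases hj : j < d + e + 1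
      · refine (hh j).congr fun i t _ => ?_
        rw [Finset.sum_eq_single j (fun b _ hb => if_neg hb)
          (fun h' => absurd (Finset.mem_range.2 hj) h'), if_pos rfl]
      · refine (IsJet.const' k 0).congr fun i t _ => ?_
        rw [Finset.sum_eq_zero fun b hb => if_neg fun hbj : b = j => hj (hbj ▸ Finset.mem_range.1 hb)])
  have dp : ∀ i t, (p i t).natDegree = d + e := fun i t => by
    rw [hpqr, (mq i t).natDegree_mul (mr i t), dq, dr]
  have eH' : ∀ i t, |t| ≤ 1 → p i t - p i 0 = C t * H.map (jetEval k i t) := fun i t ht => by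
    ext j
    rw [eH, coeff_sub, coeff_C_mul, finsetSum_coeff]
    simp only [coeff_monomial]
    by_cases hj : j < d + e + 1
    · rw [Finset.sum_eq_single j (fun b _ hb => if_neg hb)
        (fun h' => absurd (Finset.mem_range.2 hj) h'), if_pos rfl]
      have h1 := e1 j i t ht
      have h2 := e1 j i 0 (by simp)
      simp only [zero_mul, add_zero] at h1 h2
      rw [h1, h2]
      ring
    · rw [Finset.sum_eq_zero fun b hb => if_neg fun hbj : b = j => hj (hbj ▸ Finset.mem_range.1 hb),
        coeff_eq_zero_of_natDegree_lt (by rw [dp]; lia),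
        coeff_eq_zero_of_natDegree_lt (by rw [dp]; lia)]
      simp
  have monic_of : ∀ {F : (jetRing ι k)[X]} {f : ι → ℝ → ℝ[X]} {N : ℕ}, F.natDegree ≤ N →
      (∀ j, (F.coeff j : ι → ℝ → ℝ) = fun i t => (f i t).coeff j) → (∀ i t, (f i t).Monic) →
      (∀ i t, (f i t).natDegree = N) → F.coeff N = 1 := fun {F f N} _ hc mf df => by
    apply Subtype.ext
    rw [hc]
    funext i t
    rw [← df i t]
    exact (mf i t).coeff_natDegree
  have hQ1 := monic_of dQ cQ (fun i _ => mq i 0) fun i _ => dq i 0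
  have hR1 := monic_of dR cR mr dr
  have mQ : Q.Monic := monic_of_natDegree_le_of_coeff_eq_one d dQ hQ1
  have h10 : (1 : jetRing ι k) ≠ 0 := fun h => by
    have := congrArg (jetEval k hι.some 0) h
    simp at this
  have dQ' : Q.natDegree = d := natDegree_eq_of_le_of_coeff_ne_zero dQ (by rw [hQ1]; exact h10)
  have dR' : R.natDegree = e := natDegree_eq_of_le_of_coeff_ne_zero dR (by rw [hR1]; exact h10)
  -- `Q` is frozen at time `0` while `R` moves, which is why `sep` compares roots at different
  -- times. The resultant is a product of `d * e` root differences, each at least `ε` in absolute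
  -- value.
  let ρ : jetRing ι k := resultant Q R
  have hρ : ∀ i t, ε ^ (d * e) ≤ |(ρ : ι → ℝ → ℝ) i t| := fun i t => by
    have h1 : (ρ : ι → ℝ → ℝ) i t = resultant (q i 0) (r i t) := by
      rw [← jetEval_apply, ← resultant_map_map, eQ, eR, dQ', dR', dq, dr]
    rw [h1, resultant_eq_prod_roots_sub _ _ (mq i 0) (mr i t) (sq i 0) (sr i t)]
    have h2 : d * e = (((q i 0).roots ×ˢ (r i t).roots).map fun ij => ij.1 - ij.2).card := by
      rw [Multiset.card_map, Multiset.card_product, ← (sq i 0).natDegree_eq_card_roots,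
        ← (sr i t).natDegree_eq_card_roots, dq, dr]
    rw [h2]
    refine pow_card_le_abs_prod hε.le _ fun z hz => ?_
    obtain ⟨⟨x, y⟩, hxy, rfl⟩ := Multiset.mem_map.1 hz
    rw [Multiset.mem_product] at hxy
    exact sep i 0 t x hxy.1 y hxy.2
  have hεd : 0 < ε ^ (d * e) := by positivity
  have hρ' : IsUnit ρ := by
    refine IsUnit.of_mul_eq_one ⟨_, IsJet.inv ρ.2 hεd fun i t _ => hρ i t⟩ ?_
    apply Subtype.ext
    funext i t
    exact mul_inv_cancel₀ (abs_pos.1 (hεd.trans_le (hρ i t)))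
  obtain ⟨a, b, hab⟩ := (isUnit_resultant_iff_isCoprime mQ).1 hρ'
  let U : (jetRing ι k)[X] := (b * H) %ₘ Q
  refine ⟨fun i => (q i 0).coeff j, (U.coeff j : ι → ℝ → ℝ), ?_, (U.coeff j).2, fun i t ht => ?_⟩
  · obtain ⟨M, hM⟩ := (hq j).bounded
    exact ⟨M, fun i => hM i 0 (by simp)⟩
  have hab' := congrArg (Polynomial.map (jetEval k i t)) hab
  simp only [Polynomial.map_add, Polynomial.map_mul, Polynomial.map_one, eQ, eR] at hab'
  have hU : U.map (jetEval k i t) = (b.map (jetEval k i t) * H.map (jetEval k i t)) %ₘ q i 0 := by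
    rw [map_modByMonic _ mQ, Polynomial.map_mul, eQ]
  have hdeg : (q i t - q i 0).degree < (q i 0).degree := by
    rw [← degree_sub_eq_right_of_degree_lt (p := 0) (q := q i 0)]
    · rw [zero_sub, degree_neg]
      have h3 : (q i t).degree = (q i 0).degree := by
        rw [degree_eq_natDegree (mq i t).ne_zero, degree_eq_natDegree (mq i 0).ne_zero, dq, dq]
      exact h3 ▸ degree_sub_lt_left h3 (mq i t).ne_zero
        ((mq i t).leadingCoeff.trans (mq i 0).leadingCoeff.symm)
    · rw [degree_zero, bot_lt_iff_ne_bot, Ne, degree_eq_bot]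
      exact (mq i 0).ne_zero
  have hmod := (div_modByMonic_unique
    (f := t • (b.map (jetEval k i t) * H.map (jetEval k i t)))
    (-(a.map (jetEval k i t) * (q i t - q i 0) - b.map (jetEval k i t) * (r i t - r i 0)))
    (q i t - q i 0) (mq i 0) ⟨by
      have h4 := eH' i t ht
      rw [hpqr, hpqr] at h4
      rw [smul_eq_C_mul]
      linear_combination (b.map (jetEval k i t)) * h4 - (q i t - q i 0) * hab', hdeg⟩).2
  rw [smul_modByMonic, ← hU] at hmod
  have := congrArg (fun f => coeff f j) hmod
  simp only [coeff_smul, coeff_map, jetEval_apply, coeff_sub, smul_eq_mul] at this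
  linarith

/-- If a family with uniform jets of order `m` is the product of two real-rooted families with
uniformly separated bounded roots, then the factors have uniform jets of order `m`. -/
lemma isJet_coeff_of_mul {d e m : ℕ} {p q r : ι → ℝ → ℝ[X]} (mq : ∀ i t, (q i t).Monic)
    (mr : ∀ i t, (r i t).Monic) (dq : ∀ i t, (q i t).natDegree = d)
    (dr : ∀ i t, (r i t).natDegree = e) (sq : ∀ i t, (q i t).Splits) (sr : ∀ i t, (r i t).Splits)
    (hpqr : ∀ i t, p i t = q i t * r i t) (hp : ∀ j, IsJet m fun i t => (p i t).coeff j)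
    (hq : ∀ j, IsJet 0 fun i t => (q i t).coeff j) (hr : ∀ j, IsJet 0 fun i t => (r i t).coeff j)
    {ε : ℝ} (hε : 0 < ε)
    (sep : ∀ i s t, ∀ x ∈ (q i s).roots, ∀ y ∈ (r i t).roots, ε ≤ |x - y|) (j : ℕ) :
    IsJet m fun i t => (q i t).coeff j := by
  -- Each factor gains an order only if both have the previous one, so both are raised together.
  suffices H : ∀ k ≤ m, (∀ j, IsJet k fun i t => (q i t).coeff j) ∧
      ∀ j, IsJet k fun i t => (r i t).coeff j from (H m le_rfl).1 j
  intro k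
  induction k with
  | zero => exact fun _ => ⟨hq, hr⟩
  | succ k ih =>
    intro hk
    obtain ⟨h1, h2⟩ := ih (by lia)
    have hp' : ∀ j, IsJet (k + 1) fun i t => (p i t).coeff j := fun j => (hp j).mono hk
    exact ⟨isJet_succ_coeff_of_mul mq mr dq dr sq sr hpqr hp' h1 h2 hε sep,
      isJet_succ_coeff_of_mul mr mq dr dq sr sq (fun i t => by rw [hpqr, mul_comm]) hp' h2 h1 hε
        fun i s t x hx y hy => by rw [abs_sub_comm]; exact sep i t s y hy x hx⟩

end splitting

/-! ### Jet families, root germs and uniform Lipschitz bounds -/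

/-- A family of monic real-rooted polynomials of degree `n` whose coefficients have uniform jets of
order `m`. -/
structure JetFamily {ι : Type} (n m : ℕ) (p : ι → ℝ → ℝ[X]) : Prop where
  monic : ∀ i t, (p i t).Monic
  natDegree : ∀ i t, (p i t).natDegree = n
  splits : ∀ i t, (p i t).Splits
  coeff : ∀ j, IsJet m fun i t => (p i t).coeff j

/-- `r i` is, near `0`, a root of `p i` that is continuous at `0`. -/
structure RootGerm {ι : Type} (p : ι → ℝ → ℝ[X]) (r : ι → ℝ → ℝ) : Prop where
  isRoot : ∀ i, ∀ᶠ t in 𝓝 0, (p i t).IsRoot (r i t)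
  continuousAt : ∀ i, ContinuousAt (r i) 0

/-- The functions `r i` are Lipschitz at `0` with a common constant. -/
def LipAtZero {ι : Type} (r : ι → ℝ → ℝ) : Prop :=
  ∃ L : ℝ, ∀ i, ∀ᶠ t in 𝓝 0, |r i t - r i 0| ≤ L * |t|

/-- The roots of families of degree `n` with uniform jets of order `n` are Lipschitz at `0` with a
common constant. -/
def RootsLipschitz (n : ℕ) : Prop :=
  ∀ (ι : Type) (p : ι → ℝ → ℝ[X]) (r : ι → ℝ → ℝ), JetFamily n n p → RootGerm p r → LipAtZero r

/-- A `JetFamily` has one degree for all indices. When an integer such as a cluster size varies with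
the index but is bounded, the family is cut into finitely many subfamilies and their constants are
added. -/
lemma LipAtZero.of_cover {ι : Type} {r : ι → ℝ → ℝ} (f : ι → ℕ) (N : ℕ) (hf : ∀ i, f i ≤ N)
    (h : ∀ d ≤ N, LipAtZero fun i : {i // f i = d} => r i) : LipAtZero r := by
  have : ∀ d, ∃ L : ℝ, d ≤ N → ∀ i : {i // f i = d}, ∀ᶠ t in 𝓝 0,
      |r i t - r i 0| ≤ L * |t| := fun d => by
    by_cases hd : d ≤ N
    · obtain ⟨L, hL⟩ := h d hd
      exact ⟨L, fun _ => hL⟩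
    · exact ⟨0, fun h => absurd h hd⟩
  choose L hL using this
  refine ⟨∑ d ∈ Finset.range (N + 1), |L d|, fun i => ?_⟩
  filter_upwards [hL (f i) (hf i) ⟨i, rfl⟩] with t ht
  refine ht.trans (mul_le_mul_of_nonneg_right ((le_abs_self _).trans ?_) (abs_nonneg _))
  exact Finset.single_le_sum (f := fun d => |L d|) (fun _ _ => abs_nonneg _)
    (Finset.mem_range.2 (Nat.lt_succ_of_le (hf i)))

lemma LipAtZero.of_comp_mul {ι : Type} {r : ι → ℝ → ℝ} {ρ : ℝ} (hρ : 0 < ρ)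
    (h : LipAtZero fun i t => r i (ρ * t)) : LipAtZero r := by
  obtain ⟨L, hL⟩ := h
  refine ⟨L / ρ, fun i => ?_⟩
  have ht : Filter.Tendsto (fun t : ℝ => ρ⁻¹ * t) (𝓝 0) (𝓝 0) := by
    have : ContinuousAt (fun t : ℝ => ρ⁻¹ * t) 0 := by fun_prop
    simpa [ContinuousAt] using this
  filter_upwards [ht.eventually (hL i)] with t h1
  rw [mul_inv_cancel_left₀ hρ.ne', mul_zero, abs_mul, abs_inv, abs_of_pos hρ] at h1
  rw [div_eq_mul_inv, mul_assoc]
  exact h1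

/-- Used to see that a cluster keeps its number of roots when the roots move a little. -/
lemma Multiset.Rel.card_filter_eq {α β : Type*} {R : α → β → Prop} {s : Multiset α}
    {t : Multiset β} (h : Multiset.Rel R s t) (A : α → Prop) (B : β → Prop) [DecidablePred A]
    [DecidablePred B] (hAB : ∀ x ∈ s, ∀ y ∈ t, R x y → (A x ↔ B y)) :
    (s.filter A).card = (t.filter B).card := by
  induction h with
  | zero => simp
  | cons hab _ ih =>
    rename_i a b s t _
    have h1 := hAB a (Multiset.mem_cons_self _ _) b (Multiset.mem_cons_self _ _) hab
    have h2 := ih fun x hx y hy => hAB x (Multiset.mem_cons_of_mem hx) y (Multiset.mem_cons_of_mem hy)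
    by_cases hA : A a
    · rw [Multiset.filter_cons_of_pos _ hA, Multiset.filter_cons_of_pos _ (h1.1 hA)]
      simp [h2]
    · rw [Multiset.filter_cons_of_neg _ hA, Multiset.filter_cons_of_neg _ (fun hB => hA (h1.2 hB))]
      exact h2

namespace JetFamily

variable {ι : Type} {n m : ℕ} {p : ι → ℝ → ℝ[X]}

lemma exists_bound (hp : JetFamily n m p) :
    ∃ B : ℝ, 0 ≤ B ∧ ∀ j ≤ n, ∀ i t, |t| ≤ 1 → |(p i t).coeff j| ≤ B := by
  choose M hM using fun j => (hp.coeff j).bounded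
  refine ⟨∑ j ∈ Finset.range (n + 1), |M j|, Finset.sum_nonneg fun _ _ => abs_nonneg _,
    fun j hj i t ht => ((hM j i t ht).trans (le_abs_self _)).trans ?_⟩
  exact Finset.single_le_sum (f := fun d => |M d|) (fun _ _ => abs_nonneg _)
    (Finset.mem_range.2 (Nat.lt_succ_of_le hj))

lemma exists_lipschitz (hp : JetFamily n m p) (hm : 1 ≤ m) :
    ∃ L : ℝ, 0 ≤ L ∧ ∀ j ≤ n, ∀ i t, |t| ≤ 1 → |(p i t).coeff j - (p i 0).coeff j| ≤ L * |t| := by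
  choose M _ hM using fun j => (hp.coeff j).lipschitz hm
  refine ⟨∑ j ∈ Finset.range (n + 1), |M j|, Finset.sum_nonneg fun _ _ => abs_nonneg _,
    fun j hj i t ht => (hM j i t ht).trans (mul_le_mul_of_nonneg_right
      ((le_abs_self _).trans ?_) (abs_nonneg _))⟩
  exact Finset.single_le_sum (f := fun d => |M d|) (fun _ _ => abs_nonneg _)
    (Finset.mem_range.2 (Nat.lt_succ_of_le hj))

end JetFamily

/-! ### Splitting off a cluster of roots -/

/-- The part of the factorization of `p` into linear factors given by the roots satisfying `N`. -/
noncomputable def rootFactor (N : ℝ → Prop) (p : ℝ[X]) : ℝ[X] :=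
  open Classical in ((p.roots.filter N).map fun x => X - C x).prod

section rootFactor

open Classical

variable (N : ℝ → Prop) (p : ℝ[X])

lemma monic_rootFactor : (rootFactor N p).Monic :=
  monic_multiset_prod_of_monic _ _ fun x _ => monic_X_sub_C x

lemma roots_rootFactor : (rootFactor N p).roots = p.roots.filter N :=
  roots_multiset_prod_X_sub_C _

lemma mem_roots_rootFactor {x : ℝ} : x ∈ (rootFactor N p).roots ↔ x ∈ p.roots ∧ N x := by
  rw [roots_rootFactor, Multiset.mem_filter]

lemma natDegree_rootFactor : (rootFactor N p).natDegree = (p.roots.filter N).card :=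
  natDegree_multiset_prod_X_sub_C_eq_card _

lemma splits_rootFactor : (rootFactor N p).Splits :=
  Splits.multisetProd fun f hf => by
    obtain ⟨x, _, rfl⟩ := Multiset.mem_map.1 hf
    exact Splits.X_sub_C x

lemma rootFactor_mul_rootFactor_not {p : ℝ[X]} (hm : p.Monic) (hs : p.Splits) :
    rootFactor N p * rootFactor (fun x => ¬ N x) p = p := by
  rw [rootFactor, rootFactor, ← Multiset.prod_add, ← Multiset.map_add]
  have h : ∀ d : DecidablePred fun x => ¬ N x, p.roots.filter N +
      @Multiset.filter _ (fun x => ¬ N x) d p.roots = p.roots := fun d => by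
    ext x
    by_cases hx : N x <;> simp [hx]
  rw [h]
  exact (hs.eq_prod_roots_of_monic hm).symm

end rootFactor

open Classical in
/-- If the root `r` lies in a cluster of at most `d` roots that is uniformly separated from the other
roots, then it suffices to treat families of degree at most `d`. -/
lemma lipAtZero_of_cluster {ι : Type} {n m d : ℕ} {p : ι → ℝ → ℝ[X]} {r : ι → ℝ → ℝ} (hm : 1 ≤ m)
    (hp : JetFamily n m p) (hr : RootGerm p r) (hdm : d ≤ m) (IH : ∀ d' ≤ d, RootsLipschitz d')
    (S : ι → Set ℝ) {g : ℝ} (hg : 0 < g) (hrS : ∀ i, r i 0 ∈ S i)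
    (gap : ∀ i, ∀ x ∈ (p i 0).roots, ∀ y ∈ (p i 0).roots, x ∈ S i → y ∉ S i → g ≤ |x - y|)
    (hcard : ∀ i, ((p i 0).roots.filter (· ∈ S i)).card ≤ d) : LipAtZero r := by
  obtain ⟨B, hB0, hB⟩ := hp.exists_bound
  obtain ⟨L, hL0, hL⟩ := hp.exists_lipschitz hm
  obtain ⟨η, hη, hrel⟩ := exists_rel_roots n (B := B) (ε := g / 3) (by positivity)
  -- Within time `ρ` the coefficients move by at most `η`, hence the roots by at most `g / 3`.
  let ρ : ℝ := min 1 (η / (L + 1))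
  have hρ0 : 0 < ρ := lt_min one_pos (by positivity)
  have hρ1 : ρ ≤ 1 := min_le_left _ _
  have hρη : L * ρ ≤ η := by
    have : ρ ≤ η / (L + 1) := min_le_right _ _
    rw [le_div_iff₀ (by positivity)] at this
    nlinarith
  -- Time is truncated because a `JetFamily` prescribes the degree of the factor for every real `t`,
  -- while the roots are under control only for short times.
  let τ : ℝ → ℝ := fun t => ρ * max (-1) (min t 1)
  have hτ : ∀ t, |τ t| ≤ ρ := fun t => by
    simp only [τ]
    rw [abs_mul, abs_of_pos hρ0]
    refine mul_le_of_le_one_right hρ0.le (abs_le.2 ⟨le_max_left _ _, ?_⟩)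
    exact max_le (by norm_num) (min_le_right _ _)
  have hτ' : ∀ t, |t| ≤ 1 → τ t = ρ * t := fun t ht => by
    have := abs_le.1 ht
    simp only [τ]
    rw [min_eq_left this.2, max_eq_right this.1]
  have hτ0 : τ 0 = 0 := by rw [hτ' 0 (by simp), mul_zero]
  have hτc : ContinuousAt τ 0 := by fun_prop
  let P : ι → ℝ → ℝ[X] := fun i t => p i (τ t)
  have hPrel : ∀ i t, Multiset.Rel (fun x y => |x - y| ≤ g / 3) (p i 0).roots (P i t).roots :=
    fun i t => by
      refine hrel _ _ (hp.monic _ _) (hp.monic _ _) (hp.natDegree _ _) (hp.natDegree _ _)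
        (hp.splits _ _) (hp.splits _ _) (fun k hk => hB k hk.le i 0 (by simp))
        (fun k hk => hB k hk.le i _ ((hτ t).trans hρ1)) fun k hk => ?_
      rw [abs_sub_comm]
      refine (hL k hk.le i _ ((hτ t).trans hρ1)).trans (le_trans ?_ hρη)
      gcongr
      exact hτ t
  -- With margin `g / 3`, a root at a later time satisfies `N` exactly when the root at time `0`
  -- matched to it lies in the cluster: otherwise two roots separated by `g` would be within `2 g /
  -- 3`.
  let N : ι → ℝ → Prop := fun i x => ∃ y ∈ (p i 0).roots, y ∈ S i ∧ |x - y| ≤ g / 3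
  have hNS : ∀ i, ∀ x ∈ (p i 0).roots, ∀ y, |x - y| ≤ g / 3 → (x ∈ S i ↔ N i y) :=
    fun i x hx y hxy => by
      refine ⟨fun hxS => ⟨x, hx, hxS, by rwa [abs_sub_comm]⟩, ?_⟩
      rintro ⟨z, hz, hzS, hyz⟩
      by_contra hxS
      have h1 := gap i z hz x hx hzS hxS
      have h2 : |z - x| ≤ g / 3 + g / 3 := by
        calc |z - x| = |-(y - z) + -(x - y)| := by congr 1; ring
          _ ≤ |y - z| + |x - y| := by
            refine (abs_add_le _ _).trans ?_
            rw [abs_neg, abs_neg]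
          _ ≤ _ := add_le_add hyz hxy
      linarith
  let δ : ι → ℕ := fun i => ((p i 0).roots.filter (· ∈ S i)).card
  have hδ : ∀ i t, (rootFactor (N i) (P i t)).natDegree = δ i := fun i t =>
    (natDegree_rootFactor _ _).trans ((hPrel i t).card_filter_eq _ _ fun x hx y _ hxy => hNS i x hx y hxy).symm
  let R : ℝ := 1 + n * B
  have hroots : ∀ i t, ∀ x ∈ (P i t).roots, |x| ≤ R := fun i t x hx => by
    have := (hp.monic i (τ t)).abs_le_of_isRoot (B := B) (fun k hk => hB k
      (by rw [hp.natDegree] at hk; exact hk.le) i _ ((hτ t).trans hρ1)) (mem_roots'.1 hx).2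
    rwa [hp.natDegree] at this
  have hbdd : ∀ (M : ι → ℝ → Prop) (e : ι → ℕ),
      (∀ i t, (rootFactor (M i) (P i t)).natDegree = e i) → ∀ d' j,
      IsJet 0 fun (i : {i // e i = d'}) t => (rootFactor (M i) (P i t)).coeff j :=
    fun M e he d' j => by
      refine ⟨R ^ (d' - j) * d'.choose j, fun i t _ => ?_⟩
      have := (splits_rootFactor (M i) (P i t)).abs_coeff_le (monic_rootFactor _ _) (B := R)
        (fun x hx => by
          exact hroots _ _ x ((mem_roots_rootFactor _ _).1 hx).1) j
      rwa [he, i.2] at this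
  -- The degree of the cluster factor is constant in `t` but may depend on `i`; the index type is
  -- cut accordingly.
  refine LipAtZero.of_comp_mul hρ0 (LipAtZero.of_cover δ d hcard fun d' hd' => ?_)
  suffices h : LipAtZero fun (i : {i // δ i = d'}) t => r i (τ t) by
    obtain ⟨L, hL⟩ := h
    refine ⟨L, fun i => ?_⟩
    have h1 : ∀ᶠ t : ℝ in 𝓝 0, |t| ≤ 1 := by
      have : Metric.closedBall (0 : ℝ) 1 ∈ 𝓝 (0 : ℝ) := Metric.closedBall_mem_nhds _ one_pos
      filter_upwards [this] with t ht
      simpa using ht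
    filter_upwards [hL i, h1] with t ht ht1
    simpa only [hτ' t ht1, hτ0, mul_zero] using ht
  refine IH d' hd' {i // δ i = d'} (fun i t => rootFactor (N i) (P i t)) _ ⟨fun i t => monic_rootFactor _ _,
    fun i t => by rw [hδ, i.2], fun i t => splits_rootFactor _ _,
    fun j => ?_⟩ ⟨fun i => ?_, fun i => ?_⟩
  · have hcompl : ∀ i t, (rootFactor (fun x => ¬ N i x) (P i t)).natDegree = n - δ i :=
      fun i t => by
        have h1 := (monic_rootFactor (N i) (P i t)).natDegree_mul
          (monic_rootFactor (fun x => ¬ N i x) (P i t))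
        rw [rootFactor_mul_rootFactor_not _ (hp.monic _ _) (hp.splits _ _), hδ, hp.natDegree] at h1
        lia
    refine (isJet_coeff_of_mul (d := d') (e := n - d') (m := m)
      (p := fun (i : {i // δ i = d'}) t => P i t)
      (r := fun i t => rootFactor (fun x => ¬ N i x) (P i t))
      (fun i t => monic_rootFactor _ _) (fun i t => monic_rootFactor _ _)
      (fun i t => by rw [hδ, i.2])
      (fun i t => by rw [hcompl, i.2])
      (fun i t => splits_rootFactor _ _) (fun i t => splits_rootFactor _ _)
      (fun i t => (rootFactor_mul_rootFactor_not _ (hp.monic _ _) (hp.splits _ _)).symm)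
      (fun j => ?_) (hbdd N δ hδ d') (fun j => ?_) (ε := g / 3) (by positivity) ?_ j).mono
      (hd'.trans hdm)
    · refine ((hp.coeff j).reparam (fun i : {i // δ i = d'} => (i : ι)) (c := fun _ => ρ)
        fun _ => by rwa [abs_of_pos hρ0]).congr fun i t ht => ?_
      simp only [P, hτ' t ht]
    · obtain ⟨M, hM⟩ := hbdd (fun i x => ¬ N i x) (fun i => n - δ i) hcompl (n - d') j
      exact ⟨M, fun i t ht => hM ⟨i, by rw [i.2]⟩ t ht⟩
    -- Both roots are compared with roots at time `0`, which leaves `g - g / 3 - g / 3`, even for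
    -- different times.
    · intro i s t x hx y hy
      rw [mem_roots_rootFactor] at hx hy
      obtain ⟨x', hx', hxS, hxx'⟩ := hx.2
      obtain ⟨y', hy', hyy'⟩ := Multiset.exists_mem_of_rel_of_mem (Multiset.rel_flip.2 (hPrel i t)) hy.1
      have hyS : y' ∉ S i := fun h => hy.2 ((hNS i y' hy' y hyy').1 h)
      have h1 := gap i x' hx' y' hy' hxS hyS
      have h2 : |x' - y'| ≤ |x - x'| + |x - y| + |y' - y| := by
        calc |x' - y'| = |-(x - x') + (x - y) + -(y' - y)| := by congr 1; ring
          _ ≤ _ := by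
            refine (abs_add_three _ _ _).trans ?_
            rw [abs_neg, abs_neg]
      change |y' - y| ≤ g / 3 at hyy'
      linarith
  · have h1 : Filter.Tendsto τ (𝓝 0) (𝓝 0) := by simpa [ContinuousAt, hτ0] using hτc
    have h0 : (r i 0) ∈ (p i 0).roots :=
      (mem_roots (hp.monic _ _).ne_zero).2 (hr.isRoot i).self_of_nhds
    have h2 : ∀ᶠ t in 𝓝 0, |r i t - r i 0| ≤ g / 3 := by
      have := Metric.tendsto_nhds.1 (hr.continuousAt i) (g / 3) (by positivity)
      filter_upwards [this] with t ht
      exact ht.le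
    filter_upwards [h1.eventually (hr.isRoot i), h1.eventually h2] with t ht1 ht2
    have : r i (τ t) ∈ (rootFactor (N i) (P i t)).roots := by
      rw [mem_roots_rootFactor]
      exact ⟨(mem_roots (hp.monic _ _).ne_zero).2 ht1, r i 0, h0, hrS i, ht2⟩
    exact (mem_roots'.1 this).2
  · refine ContinuousAt.comp (g := r i) ?_ hτc
    rw [hτ0]
    exact hr.continuousAt i

/-! ### Glaeser's inequality and the induction on the degree -/

namespace IsJet

variable {ι : Type} {n : ℕ} {g : ι → ℝ → ℝ}

lemma pow (hg : IsJet n g) (k : ℕ) : IsJet n fun i t => g i t ^ k :=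
  (jetRing ι n).pow_mem (mem_jetRing.2 hg) k

lemma sum {α : Type} {G : α → ι → ℝ → ℝ} (s : Finset α) (h : ∀ a ∈ s, IsJet n (G a)) :
    IsJet n fun i t => ∑ a ∈ s, G a i t := by
  have := (jetRing ι n).sum_mem h
  rw [mem_jetRing] at this
  exact this.congr fun i t _ => by simp

/-- A nonpositive function with uniform jets of order two satisfies Glaeser type bounds. -/
lemma exists_abs_le_of_nonpos (hg : IsJet 2 g) (h0 : ∀ i t, g i t ≤ 0) :
    ∃ M : ℝ, 0 ≤ M ∧ ∀ i (δ t : ℝ), 0 < δ → δ ≤ 1 → |t| ≤ δ →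
      |g i t - g i 0| ≤ -g i 0 + 2 * M * δ ^ 2 := by
  obtain ⟨c, k, -, ⟨d, h, -, ⟨M, hM⟩, hk⟩, hg⟩ := hg
  have e : ∀ i t, |t| ≤ 1 → g i t = g i 0 + t * d i + t ^ 2 * h i t := fun i t ht => by
    rw [hg i t ht, hg i 0 (by simp), hk i t ht]
    ring
  refine ⟨|M|, abs_nonneg _, fun i δ t hδ hδ1 ht => ?_⟩
  have hM' : ∀ t, |t| ≤ 1 → |h i t| ≤ |M| := fun t ht => (hM i t ht).trans (le_abs_self _)
  have hδa : |δ| ≤ 1 := by rwa [abs_of_pos hδ]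
  have hδb : |-δ| ≤ 1 := by rwa [abs_neg]
  -- Nonpositivity at both `δ` and `-δ` bounds the slope: `|d| δ ≤ -g(0) + |M| δ²`.
  have h1 := h0 i δ
  have h2 := h0 i (-δ)
  rw [e i δ hδa] at h1
  rw [e i (-δ) hδb] at h2
  have h3 := (abs_le.1 (hM' δ hδa)).1
  have h4 := (abs_le.1 (hM' (-δ) hδb)).1
  have hd : |d i| * δ ≤ -g i 0 + |M| * δ ^ 2 := by
    rcases le_total 0 (d i) with hd | hd
    · rw [abs_of_nonneg hd]
      nlinarith [mul_le_mul_of_nonneg_left h3 (sq_nonneg δ)]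
    · rw [abs_of_nonpos hd]
      nlinarith [mul_le_mul_of_nonneg_left h4 (sq_nonneg δ)]
  have ht1 := ht.trans hδ1
  rw [e i t ht1, show g i 0 + t * d i + t ^ 2 * h i t - g i 0 = t * d i + t ^ 2 * h i t by ring]
  refine (abs_add_le _ _).trans ?_
  rw [abs_mul, abs_mul, abs_pow]
  have h5 : |t| * |d i| ≤ |d i| * δ := by
    rw [mul_comm]
    exact mul_le_mul_of_nonneg_left ht (abs_nonneg _)
  have h6 : |t| ^ 2 * |h i t| ≤ δ ^ 2 * |M| := by
    have := hM' t ht1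
    gcongr
  linarith

end IsJet

lemma eventually_abs_le_one : ∀ᶠ t : ℝ in 𝓝 0, |t| ≤ 1 := by
  have : Metric.closedBall (0 : ℝ) 1 ∈ 𝓝 (0 : ℝ) := Metric.closedBall_mem_nhds _ one_pos
  filter_upwards [this] with t ht
  simpa using ht

lemma rootsLipschitz_zero : RootsLipschitz 0 := by
  refine fun ι p r hp hr => ⟨0, fun i => ?_⟩
  have := (hr.isRoot i).self_of_nhds
  rw [(hp.monic i 0).natDegree_eq_zero.1 (hp.natDegree i 0)] at this
  simp at this

lemma rootsLipschitz_one : RootsLipschitz 1 := by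
  intro ι p r hp hr
  obtain ⟨L, -, hL⟩ := hp.exists_lipschitz le_rfl
  have key : ∀ i t, (p i t).IsRoot (r i t) → r i t = -(p i t).coeff 0 := fun i t h => by
    have h1 := (hp.monic i t).coeff_natDegree
    rw [IsRoot.def, eval_eq_sum_range, hp.natDegree] at h
    rw [hp.natDegree] at h1
    simp only [Finset.sum_range_succ, Finset.sum_range_zero, h1] at h
    linarith
  refine ⟨L, fun i => ?_⟩
  filter_upwards [hr.isRoot i, eventually_abs_le_one] with t h1 h2
  rw [key i t h1, key i 0 (hr.isRoot i).self_of_nhds]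
  have := hL 0 (by simp) i t h2
  rwa [← abs_neg, show -(-(p i t).coeff 0 - -(p i 0).coeff 0) =
    (p i t).coeff 0 - (p i 0).coeff 0 by ring]

lemma Multiset.card_filter_lt_of_mem {α : Type*} {s : Multiset α} {A : α → Prop} {d : DecidablePred A}
    {y : α} (hy : y ∈ s) (hA : ¬ A y) : (s.filter A).card < s.card :=
  Multiset.card_lt_card (lt_of_le_of_ne (Multiset.filter_le _ _)
    fun h => hA (Multiset.filter_eq_self.1 h y hy))

/-- A multiset of `n` reals with zero mean and square sum `2` has a gap of size `n⁻²`. -/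
lemma exists_gap {n : ℕ} (hn : 1 ≤ n) {s : Multiset ℝ} (hs : s.card = n) (h1 : s.sum = 0)
    (h2 : (s.map fun x => x ^ 2).sum = 2) : ∃ θ : ℝ, (∀ x ∈ s, 1 / (2 * (n : ℝ) ^ 2) ≤ |x - θ|) ∧
      (∃ x ∈ s, x < θ) ∧ ∃ x ∈ s, θ < x := by
  have hn0 : (0 : ℝ) < n := by exact_mod_cast hn
  have hn1 : (1 : ℝ) ≤ n := by exact_mod_cast hn
  have nonpos : ∀ s : Multiset ℝ, s.sum = 0 → ∀ x ∈ s, 0 < x → ∃ y ∈ s, y ≤ 0 :=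
    fun s hs x hx hx0 => by
      by_contra! h
      have := Multiset.single_le_sum (fun y hy => (h y hy).le) x hx
      linarith
  -- If all absolute values were below `1 / n`, the squares would sum to at most `1`, not `2`.
  obtain ⟨x, hx, hxn⟩ : ∃ x ∈ s, 1 / (n : ℝ) ≤ |x| := by
    by_contra! h
    have h3 : (s.map fun x => x ^ 2).sum ≤ (s.map fun x => x ^ 2).card • (1 / (n : ℝ)) := by
      refine Multiset.sum_le_card_nsmul _ _ fun y hy => ?_
      obtain ⟨x, hx, rfl⟩ := Multiset.mem_map.1 hy
      have h4 := h x hx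
      have h5 : 1 / (n : ℝ) ≤ 1 := by rwa [div_le_one hn0]
      rw [← sq_abs]
      nlinarith [abs_nonneg x]
    rw [h2, Multiset.card_map, hs, nsmul_eq_mul, mul_one_div_cancel hn0.ne'] at h3
    norm_num at h3
  have hpos : 0 < 1 / (n : ℝ) := by positivity
  -- As the sum is zero, some element lies at `0` or on the other side of it, at distance at least
  -- `1 / n` from `x`.
  obtain ⟨u, hu, v, hv, huv⟩ : ∃ u ∈ s, ∃ v ∈ s, u + 1 / n ≤ v := by
    rcases le_total 0 x with h0 | h0
    · rw [abs_of_nonneg h0] at hxn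
      obtain ⟨y, hy, hy0⟩ := nonpos s h1 x hx (by linarith)
      exact ⟨y, hy, x, hx, by linarith⟩
    · rw [abs_of_nonpos h0] at hxn
      obtain ⟨y, hy, hy0⟩ := nonpos (s.map fun x => -x) (by rw [Multiset.sum_map_neg', h1, neg_zero])
        (-x) (Multiset.mem_map_of_mem _ hx) (by linarith)
      obtain ⟨z, hz, rfl⟩ := Multiset.mem_map.1 hy
      exact ⟨x, hx, z, hz, by linarith⟩
  let w : ℝ := 1 / (n : ℝ) ^ 2
  have hw : 0 < w := by positivity
  have hnw : n * w = 1 / n := by simp only [w]; field_simp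
  -- Pigeonhole: of the `n` disjoint open intervals of length `1 / n²` to the right of `u`, one
  -- misses the at most `n - 1` values other than `u`. Its midpoint is `θ`.
  obtain ⟨k, hk⟩ : ∃ k : Fin n, ∀ x ∈ s, ¬ (u + k * w < x ∧ x < u + (k + 1) * w) := by
    by_contra! h
    choose f hf hf1 hf2 using h
    have hcard : (s.toFinset.erase u).card < (Finset.univ : Finset (Fin n)).card := by
      rw [Finset.card_univ, Fintype.card_fin]
      have := Finset.card_erase_lt_of_mem (Multiset.mem_toFinset.2 hu)
      have := Multiset.toFinset_card_le s
      lia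
    obtain ⟨i, -, j, -, hij, hfij⟩ := Finset.exists_ne_map_eq_of_card_lt_of_maps_to (f := f) hcard
      (fun i _ => by
        rw [Finset.mem_coe, Finset.mem_erase, Multiset.mem_toFinset]
        refine ⟨fun h => ?_, hf i⟩
        have h3 := hf1 i
        have : 0 ≤ (i : ℝ) * w := by positivity
        linarith)
    have lt_of : ∀ i j : Fin n, f i = f j → ¬ i < j := fun i j hf hlt => by
      have h3 := hf2 i
      have h4 := hf1 j
      have h5 : (i : ℝ) + 1 ≤ j := by exact_mod_cast hlt
      have := mul_le_mul_of_nonneg_right h5 hw.le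
      rw [hf] at h3
      linarith
    rcases lt_or_gt_of_ne hij with h | h
    · exact lt_of i j hfij h
    · exact lt_of j i hfij.symm h
  have hk1 : (k : ℝ) + 1 ≤ n := by exact_mod_cast k.2
  have hk2 := mul_le_mul_of_nonneg_right hk1 hw.le
  have hk0 : 0 ≤ (k : ℝ) * w := by positivity
  refine ⟨u + k * w + w / 2, fun x hx => ?_, ⟨u, hu, by linarith⟩, v, hv, by linarith⟩
  have hw2 : 1 / (2 * (n : ℝ) ^ 2) = w / 2 := by simp only [w]; ring
  rw [hw2]
  by_contra! h
  rw [abs_lt] at h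
  exact hk x hx ⟨by linarith [h.1], by linarith [h.2]⟩

section

variable {ι : Type} {n : ℕ} {p : ι → ℝ → ℝ[X]} {r : ι → ℝ → ℝ}

/-- The normalization makes the squares of the roots at time `0` sum to `2`, so `exists_gap` cuts
them at some `θ i` with a margin depending only on `n`. The roots on the same side of `θ i` as `r i
0` form a cluster that omits at least one root, so degrees below `n` suffice. -/
lemma lipAtZero_of_normalized (hn : 2 ≤ n) (IH : ∀ d < n, RootsLipschitz d)
    (hp : JetFamily n n p) (hr : RootGerm p r) (h1 : ∀ i, (p i 0).coeff (n - 1) = 0)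
    (h2 : ∀ i, (p i 0).coeff (n - 2) = -1) : LipAtZero r := by
  classical
  have hgap : ∀ i, ∃ θ : ℝ, (∀ x ∈ (p i 0).roots, 1 / (2 * (n : ℝ) ^ 2) ≤ |x - θ|) ∧
      (∃ x ∈ (p i 0).roots, x < θ) ∧ ∃ x ∈ (p i 0).roots, θ < x := fun i => by
    have hd := hp.natDegree i 0
    refine exists_gap (by lia) ((hp.splits i 0).natDegree_eq_card_roots.symm.trans hd) ?_ ?_
    · have := (hp.splits i 0).nextCoeff_eq_neg_sum_roots_of_monic (hp.monic i 0)
      rw [nextCoeff_of_natDegree_pos (by lia), hd, h1] at this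
      linarith
    · rw [(hp.splits i 0).sum_sq_roots (hp.monic i 0) (by lia) (by rw [hd, h1]), hd, h2]
      norm_num
  choose θ hθ hlt hgt using hgap
  have hn0 : (0 : ℝ) < n := by
    have : 0 < n := by lia
    exact_mod_cast this
  refine lipAtZero_of_cluster (d := n - 1) (by lia) hp hr (by lia) (fun d hd => IH d (by lia))
    (fun i => {x | x < θ i ↔ r i 0 < θ i}) (g := 1 / (2 * (n : ℝ) ^ 2)) (by positivity)
    (fun i => Iff.rfl) (fun i x hx y hy hxS hyS => ?_) fun i => ?_
  · have hx1 := hθ i x hx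
    have hy1 := hθ i y hy
    have hpos : 0 < 1 / (2 * (n : ℝ) ^ 2) := by positivity
    simp only [Set.mem_ofPred_eq] at hxS hyS
    have : (x < θ i ∧ ¬ y < θ i) ∨ (¬ x < θ i ∧ y < θ i) := by tauto
    rcases this with ⟨ha, hb⟩ | ⟨ha, hb⟩
    · rw [abs_of_neg (by linarith)] at hx1
      rw [abs_of_neg (by linarith)]
      linarith
    · rw [abs_of_neg (by linarith)] at hy1
      rw [abs_of_pos (by linarith)]
      linarith
  · have hc : (p i 0).roots.card = n :=
      (hp.splits i 0).natDegree_eq_card_roots.symm.trans (hp.natDegree i 0)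
    have hex : ∃ y ∈ (p i 0).roots, ¬ (y < θ i ↔ r i 0 < θ i) := by
      by_cases h : r i 0 < θ i
      · obtain ⟨y, hy, hy1⟩ := hgt i
        exact ⟨y, hy, fun h' => by linarith [h'.2 h]⟩
      · obtain ⟨y, hy, hy1⟩ := hlt i
        exact ⟨y, hy, fun h' => h (h'.1 hy1)⟩
    obtain ⟨y, hy, hyS⟩ := hex
    refine Nat.le_sub_one_of_lt ?_
    conv_rhs => rw [← hc]
    exact Multiset.card_filter_lt_of_mem hy hyS

lemma JetFamily.coeff_nonpos (hn : 2 ≤ n) {m : ℕ} (hp : JetFamily n m p) {i : ι} {t : ℝ}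
    (h1 : (p i t).coeff (n - 1) = 0) : (p i t).coeff (n - 2) ≤ 0 := by
  have hd := hp.natDegree i t
  have := (hp.splits i t).sum_sq_roots (hp.monic i t) (by lia) (by rw [hd, h1])
  rw [hd] at this
  have h0 : 0 ≤ ((p i t).roots.map fun x => x ^ 2).sum :=
    Multiset.sum_nonneg fun y hy => by
      obtain ⟨x, _, rfl⟩ := Multiset.mem_map.1 hy
      positivity
  linarith

lemma JetFamily.sq_le (hn : 2 ≤ n) {m : ℕ} (hp : JetFamily n m p) {i : ι} {t x : ℝ}
    (h1 : (p i t).coeff (n - 1) = 0) (hx : x ∈ (p i t).roots) :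
    x ^ 2 ≤ -2 * (p i t).coeff (n - 2) := by
  have hd := hp.natDegree i t
  have := (hp.splits i t).sq_le_of_mem_roots (hp.monic i t) (by lia) (by rw [hd, h1]) hx
  rwa [hd] at this

/-- Glaeser's bound with `δ = |t|` gives `|a_2(t)| ≤ 2 M t²`, and every root satisfies `x² ≤ -2
a_2(t) ≤ 4 M t²`. -/
lemma lipAtZero_of_centered_of_eq_zero (hn : 2 ≤ n) (hp : JetFamily n n p) (hr : RootGerm p r)
    (h1 : ∀ i t, (p i t).coeff (n - 1) = 0) (h2 : ∀ i, (p i 0).coeff (n - 2) = 0) :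
    LipAtZero r := by
  obtain ⟨M, hM0, hM⟩ := ((hp.coeff (n - 2)).mono hn).exists_abs_le_of_nonpos
    fun i t => hp.coeff_nonpos hn (h1 i t)
  have hr0 : ∀ i, r i 0 = 0 := fun i => by
    have := hp.sq_le hn (h1 i 0) ((mem_roots (hp.monic i 0).ne_zero).2 (hr.isRoot i).self_of_nhds)
    rw [h2] at this
    exact pow_eq_zero_iff two_ne_zero |>.1 (le_antisymm (by linarith) (sq_nonneg _))
  refine ⟨√(4 * M), fun i => ?_⟩
  filter_upwards [hr.isRoot i, eventually_abs_le_one] with t h3 h4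
  rcases eq_or_ne t 0 with rfl | ht
  · simp
  have h5 := hp.sq_le hn (h1 i t) ((mem_roots (hp.monic i t).ne_zero).2 h3)
  have h6 := hM i |t| t (abs_pos.2 ht) h4 le_rfl
  rw [h2, sub_zero, neg_zero, zero_add] at h6
  have h7 := neg_abs_le ((p i t).coeff (n - 2))
  rw [hr0, sub_zero]
  refine abs_le_of_sq_le_sq ?_ (by positivity)
  rw [mul_pow, Real.sq_sqrt (by positivity)]
  linarith

/-- A blow-up: roots are divided by `δ i` and time runs at speed `κ * δ i`, which turns `a_2(0)`
into `-1`. The numbers `δ i` may be arbitrarily small, so everything has to be bounded independently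
of them; Glaeser's inequality and `IsJet.rescale` achieve this. -/
lemma lipAtZero_of_centered_of_ne_zero (hn : 2 ≤ n) (IH : ∀ d < n, RootsLipschitz d)
    (hp : JetFamily n n p) (hr : RootGerm p r) (h1 : ∀ i t, (p i t).coeff (n - 1) = 0)
    (h2 : ∀ i, (p i 0).coeff (n - 2) ≠ 0) : LipAtZero r := by
  have hneg : ∀ i t, (p i t).coeff (n - 2) ≤ 0 := fun i t => hp.coeff_nonpos hn (h1 i t)
  obtain ⟨M, hM0, hM⟩ := ((hp.coeff (n - 2)).mono hn).exists_abs_le_of_nonpos hneg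
  obtain ⟨B, hB0, hB⟩ := hp.exists_bound
  let δ : ι → ℝ := fun i => √(-(p i 0).coeff (n - 2))
  have hδ2 : ∀ i, δ i ^ 2 = -(p i 0).coeff (n - 2) := fun i =>
    Real.sq_sqrt (by linarith [hneg i 0])
  have hδ : ∀ i, 0 < δ i := fun i =>
    Real.sqrt_pos.2 (by linarith [lt_of_le_of_ne (hneg i 0) (h2 i)])
  let D : ℝ := 1 + B
  have hD : ∀ i, δ i ≤ D := fun i => by
    have h3 := (neg_le_abs _).trans (hB (n - 2) (by lia) i 0 (by simp))
    rw [← hδ2] at h3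
    nlinarith [hδ i]
  have hD0 : 0 < D := by positivity
  -- This makes `κ * δ i ≤ 1`, so the slowed time stays in `[-1, 1]`, and `κ ≤ 1`.
  let κ : ℝ := D⁻¹
  have hκ0 : 0 < κ := by positivity
  have hκ1 : κ ≤ 1 := inv_le_one_of_one_le₀ (by linarith)
  have hκ : ∀ i, κ * δ i ≤ 1 := fun i => by
    simp only [κ]
    rw [inv_mul_le_iff₀ hD0]
    linarith [hD i]
  have hκp : ∀ i, 0 < κ * δ i := fun i => mul_pos hκ0 (hδ i)
  let P : ι → ℝ → ℝ[X] := fun i t => (p i (κ * δ i * t)).scaleRoots (δ i)⁻¹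
  have cP : ∀ i t j, (P i t).coeff j = (δ i)⁻¹ ^ (n - j) * (p i (κ * δ i * t)).coeff j :=
    fun i t j => by rw [coeff_scaleRoots, hp.natDegree, mul_comm]
  have mP : ∀ i t, (P i t).Monic := fun i t => (monic_scaleRoots_iff _).2 (hp.monic _ _)
  have dP : ∀ i t, (P i t).natDegree = n := fun i t => by
    rw [natDegree_scaleRoots, hp.natDegree]
  have sP : ∀ i t, (P i t).Splits := fun i t => (hp.splits _ _).scaleRoots _
  have cP1 : ∀ i t, (P i t).coeff (n - 1) = 0 := fun i t => by rw [cP, h1, mul_zero]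
  -- Glaeser on the interval of radius `κ δ` gives `-a_2 ≤ 2 δ² + 2 M (κ δ)²`, then divide by `δ²`.
  have cP2 : ∀ i t, |t| ≤ 1 → -(P i t).coeff (n - 2) ≤ 2 + 2 * M := fun i t ht => by
    rw [cP, show n - (n - 2) = 2 by lia, inv_pow, ← mul_neg, inv_mul_le_iff₀ (by have := hδ i; positivity)]
    have h3 := hM i (κ * δ i) (κ * δ i * t) (hκp i) (hκ i) (by
      rw [abs_mul, abs_of_pos (hκp i)]
      exact mul_le_of_le_one_right (hκp i).le ht)
    rw [← hδ2] at h3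
    have h4 := (abs_le.1 h3).1
    have h5 : κ * δ i ≤ δ i := mul_le_of_le_one_left (hδ i).le hκ1
    have h6 : (κ * δ i) ^ 2 ≤ δ i ^ 2 := pow_le_pow_left₀ (hκp i).le h5 2
    have h7 := hδ2 i
    nlinarith
  have hPb : ∀ j, IsJet 0 fun i t => (P i t).coeff j := fun j => by
    let R : ℝ := √(2 * (2 + 2 * M))
    refine ⟨R ^ (n - j) * n.choose j, fun i t ht => ?_⟩
    have := (sP i t).abs_coeff_le (mP i t) (B := R) (fun x hx => by
      have h3 := (sP i t).sq_le_of_mem_roots (mP i t) (by rw [dP]; exact hn) (by rw [dP, cP1]) hx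
      rw [dP] at h3
      refine abs_le_of_sq_le_sq ?_ (Real.sqrt_nonneg _)
      rw [Real.sq_sqrt (by positivity)]
      linarith [cP2 i t ht]) j
    rwa [dP] at this
  have hP : JetFamily n n P := ⟨mP, dP, sP, fun j => by
    rcases le_or_gt j n with hj | hj
    · have h3 := hPb j
      simp only [cP] at h3
      simp only [cP]
      exact (hp.coeff j).rescale (j := n - j) (by lia) hδ hD
        (fun i => by rw [abs_of_pos (hκp i)]; exact hκ i) h3
    · exact (IsJet.const' n 0).congr fun i t _ => coeff_eq_zero_of_natDegree_lt (by rw [dP]; exact hj)⟩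
  have htend : ∀ i, Filter.Tendsto (fun t : ℝ => κ * δ i * t) (𝓝 0) (𝓝 0) := fun i => by
    have : ContinuousAt (fun t : ℝ => κ * δ i * t) 0 := by fun_prop
    simpa [ContinuousAt] using this
  have hR : RootGerm P fun i t => (δ i)⁻¹ * r i (κ * δ i * t) := by
    refine ⟨fun i => ?_, fun i => ?_⟩
    · filter_upwards [(htend i).eventually (hr.isRoot i)] with t ht
      have := scaleRoots_eval₂_mul (p := p i (κ * δ i * t)) (RingHom.id ℝ) (r i (κ * δ i * t)) (δ i)⁻¹
      simp only [RingHom.id_apply] at this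
      rw [IsRoot.def, ← eval₂_id, this, eval₂_id, ht, mul_zero]
    · refine continuousAt_const.mul (ContinuousAt.comp (g := r i) ?_ (by fun_prop))
      rw [mul_zero]
      exact hr.continuousAt i
  obtain ⟨L, hL⟩ := lipAtZero_of_normalized hn IH hP hR (fun i => cP1 i 0) fun i => by
    rw [cP, mul_zero, show n - (n - 2) = 2 by lia, inv_pow, hδ2, inv_mul_eq_div, div_neg,
      div_self (h2 i)]
  -- Undoing the blow-up multiplies by `δ i` and divides by `κ * δ i`; the unbounded factor cancels.
  refine ⟨L / κ, fun i => ?_⟩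
  have ht : Filter.Tendsto (fun t : ℝ => (κ * δ i)⁻¹ * t) (𝓝 0) (𝓝 0) := by
    have : ContinuousAt (fun t : ℝ => (κ * δ i)⁻¹ * t) 0 := by fun_prop
    simpa [ContinuousAt] using this
  filter_upwards [ht.eventually (hL i)] with t h3
  have hd := hδ i
  rw [mul_inv_cancel_left₀ (hκp i).ne', mul_zero, ← mul_sub, abs_mul, abs_mul, abs_inv, abs_inv,
    abs_of_pos hd, abs_of_pos (hκp i), inv_mul_le_iff₀ hd] at h3
  refine h3.trans (le_of_eq ?_)
  field_simp

lemma lipAtZero_of_centered (hn : 2 ≤ n) (IH : ∀ d < n, RootsLipschitz d)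
    (hp : JetFamily n n p) (hr : RootGerm p r) (h1 : ∀ i t, (p i t).coeff (n - 1) = 0) :
    LipAtZero r := by
  classical
  refine LipAtZero.of_cover (fun i => if (p i 0).coeff (n - 2) = 0 then 0 else 1) 1
    (fun i => by split_ifs <;> simp) fun d hd => ?_
  have hp' : JetFamily n n fun (i : {i // (if (p i 0).coeff (n - 2) = 0 then 0 else 1) = d}) t =>
      p i t := ⟨fun i => hp.monic i, fun i => hp.natDegree i, fun i => hp.splits i, fun j =>
    ((hp.coeff j).reparam Subtype.val (c := fun _ => 1) (by simp)).congr (by simp)⟩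
  have hr' : RootGerm (fun (i : {i // (if (p i 0).coeff (n - 2) = 0 then 0 else 1) = d}) t =>
      p i t) fun i t => r i t := ⟨fun i => hr.isRoot i, fun i => hr.continuousAt i⟩
  interval_cases d
  · refine lipAtZero_of_centered_of_eq_zero hn hp' hr' (fun i => h1 i) fun i => ?_
    by_contra h
    have := i.2
    simp [h] at this
  · refine lipAtZero_of_centered_of_ne_zero hn IH hp' hr' (fun i => h1 i) fun i h => ?_
    have := i.2
    simp [h] at this

end

/-- **Bronshtein's theorem**, pointwise and uniform version. -/
theorem rootsLipschitz (n : ℕ) : RootsLipschitz n := by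
  induction n using Nat.strong_induction_on with
  | _ n IH =>
    rcases Nat.lt_or_ge n 2 with hn | hn
    · interval_cases n
      · exact rootsLipschitz_zero
      · exact rootsLipschitz_one
    intro ι p r hp hr
    have hn0 : (n : ℝ) ≠ 0 := by
      have : n ≠ 0 := by lia
      exact_mod_cast this
    -- The Tschirnhaus shift: `-s` is the mean of the roots. The shift has uniform jets itself, so
    -- it preserves the jets of the coefficients and changes the root by a function that is
    -- Lipschitz at `0`.
    let s : ι → ℝ → ℝ := fun i t => (p i t).coeff (n - 1) * (n : ℝ)⁻¹
    have hs : IsJet n s := (hp.coeff (n - 1)).mul (IsJet.const' n _)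
    let P : ι → ℝ → ℝ[X] := fun i t => taylor (-s i t) (p i t)
    have cP : ∀ i t j, (P i t).coeff j = ∑ k ∈ Finset.range (n + 1),
        ((k + j).choose j : ℝ) * (p i t).coeff (k + j) * (-s i t) ^ k := fun i t j => by
      rw [taylor_coeff, eval_eq_sum_range' (n := n + 1)]
      · simp only [hasseDeriv_coeff]
      · have := natDegree_hasseDeriv_le (p i t) j
        rw [hp.natDegree] at this
        lia
    have hP : JetFamily n n P := by
      refine ⟨fun i t => ?_, fun i t => ?_, fun i t => (hp.splits i t).taylor _, fun j => ?_⟩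
      · rw [Monic, leadingCoeff_taylor]
        exact hp.monic i t
      · rw [natDegree_taylor, hp.natDegree]
      · simp only [cP]
        exact IsJet.sum _ fun k _ => ((IsJet.const' n _).mul (hp.coeff _)).mul (hs.neg.pow k)
    obtain ⟨L, hL0, hL⟩ := hs.lipschitz (by lia)
    have hsc : ∀ i, ContinuousAt (s i) 0 := fun i => by
      rw [ContinuousAt, tendsto_iff_dist_tendsto_zero]
      have h0 : Filter.Tendsto (fun t : ℝ => L * |t|) (𝓝 0) (𝓝 0) := by
        have : ContinuousAt (fun t : ℝ => L * |t|) 0 := by fun_prop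
        simpa [ContinuousAt] using this
      refine squeeze_zero' (Filter.Eventually.of_forall fun _ => dist_nonneg) ?_ h0
      filter_upwards [eventually_abs_le_one] with t ht
      exact hL i t ht
    have hR : RootGerm P fun i t => r i t + s i t := by
      refine ⟨fun i => ?_, fun i => (hr.continuousAt i).add (hsc i)⟩
      filter_upwards [hr.isRoot i] with t ht
      rw [IsRoot.def, taylor_eval, add_neg_cancel_right]
      exact ht
    obtain ⟨K, hK⟩ := lipAtZero_of_centered hn IH hP hR fun i t => by
      -- Only the terms `k = 0, 1` survive, and they give `a_1 - n * s = 0`.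
      obtain ⟨m, rfl⟩ : ∃ m, n = m + 2 := ⟨n - 2, by lia⟩
      have h1 := (hp.monic i t).coeff_natDegree
      rw [hp.natDegree] at h1
      rw [cP, Finset.sum_range_succ', Finset.sum_range_succ', Finset.sum_eq_zero fun k _ => by
        rw [coeff_eq_zero_of_natDegree_lt (by rw [hp.natDegree]; lia), mul_zero, zero_mul]]
      have h2 : 0 + 1 + (m + 2 - 1) = m + 2 := by lia
      have h3 : (m + 2).choose (m + 2 - 1) = m + 2 := by
        rw [show m + 2 - 1 = m + 1 by lia]
        exact Nat.choose_succ_self_right (m + 1)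
      simp only [h2, h3, h1, s, zero_add, Nat.choose_self, Nat.cast_one]
      field_simp
      ring
    refine ⟨K + L, fun i => ?_⟩
    filter_upwards [hK i, eventually_abs_le_one] with t h1 h2
    have h3 := hL i t h2
    calc |r i t - r i 0| = |(r i t + s i t - (r i 0 + s i 0)) + -(s i t - s i 0)| := by
          congr 1; ring
      _ ≤ K * |t| + L * |t| := by
          refine (abs_add_le _ _).trans (add_le_add h1 ?_)
          rwa [abs_neg]
      _ = _ := by ring

/-! ### From several variables to segments and back -/

section geometry

variable {m : ℕ}

local notation "E" => EuclideanSpace ℝ (Fin m)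

/-- All partial derivatives of `f` of order at most `k` are bounded by `M` on `V`, and those of order
`k` are `M`-Lipschitz on `V`. -/
structure Ck1Bound (k : ℕ) (f : EuclideanSpace ℝ (Fin m) → ℝ)
    (V : Set (EuclideanSpace ℝ (Fin m))) (M : ℝ) : Prop where
  bound : ∀ l ≤ k, ∀ j : Fin l → Fin m, ∀ y ∈ V, |partialDeriv j f y| ≤ M
  lip : ∀ j : Fin k → Fin m, ∀ y ∈ V, ∀ z ∈ V,
    |partialDeriv j f y - partialDeriv j f z| ≤ M * ‖y - z‖

lemma Ck1Bound.const_mul {k : ℕ} {f : E → ℝ} {U V : Set E} {M : ℝ} (h : Ck1Bound k f V M)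
    (hU : IsOpen U) (hVU : V ⊆ U) (hf : ContDiffOn ℝ k f U) {c : ℝ} (hc : 0 ≤ c) :
    Ck1Bound k (fun x => c * f x) V (c * M) := by
  have key : ∀ l ≤ k, ∀ j : Fin l → Fin m, ∀ y ∈ V,
      partialDeriv j (fun x => c * f x) y = c * partialDeriv j f y := fun l hl j y hy => by
    have h1 : ContDiffAt ℝ l f y :=
      (hf.contDiffAt (hU.mem_nhds (hVU hy))).of_le (by exact_mod_cast hl)
    have h2 := iteratedFDeriv_const_smul_apply (a := c) h1
    simp only [partialDeriv]
    change iteratedFDeriv ℝ l (c • f) y _ = _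
    rw [h2]
    rfl
  refine ⟨fun l hl j y hy => ?_, fun j y hy z hz => ?_⟩
  · rw [key l hl j y hy, abs_mul, abs_of_nonneg hc]
    exact mul_le_mul_of_nonneg_left (h.bound l hl j y hy) hc
  · rw [key k le_rfl j y hy, key k le_rfl j z hz, ← mul_sub, abs_mul, abs_of_nonneg hc, mul_assoc]
    exact mul_le_mul_of_nonneg_left (h.lip j y hy z hz) hc

lemma Ck1Bound.mono {k : ℕ} {f : E → ℝ} {V W : Set E} {M N : ℝ} (h : Ck1Bound k f V M)
    (hWV : W ⊆ V) (hMN : M ≤ N) : Ck1Bound k f W N :=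
  ⟨fun l hl j y hy => (h.bound l hl j y (hWV hy)).trans hMN, fun j y hy z hz =>
    (h.lip j y (hWV hy) z (hWV hz)).trans (mul_le_mul_of_nonneg_right hMN (norm_nonneg _))⟩

lemma iteratedFDeriv_apply_const_eq_sum (l : ℕ) (f : E → ℝ) (y w : E) :
    iteratedFDeriv ℝ l f y (fun _ => w) =
      ∑ j : Fin l → Fin m, (∏ s, w (j s)) * partialDeriv j f y := by
  have hw : w = ∑ s : Fin m, w s • EuclideanSpace.single s (1 : ℝ) := by
    have := (EuclideanSpace.basisFun (Fin m) ℝ).sum_repr w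
    simpa using this.symm
  conv_lhs => rw [show (fun _ : Fin l => w) =
    fun _ : Fin l => ∑ s : Fin m, w s • EuclideanSpace.single s (1 : ℝ) from funext fun _ => hw]
  rw [ContinuousMultilinearMap.map_sum]
  refine Finset.sum_congr rfl fun j _ => ?_
  rw [ContinuousMultilinearMap.map_smul_univ, smul_eq_mul]
  rfl

lemma hasDerivAt_iteratedFDeriv_line {k l : ℕ} (hl : l < k) {f : E → ℝ} {U : Set E} (hU : IsOpen U)
    (hf : ContDiffOn ℝ k f U) {x w : E} {t : ℝ} (ht : x + t • w ∈ U) :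
    HasDerivAt (fun t : ℝ => iteratedFDeriv ℝ l f (x + t • w) fun _ => w)
      (iteratedFDeriv ℝ (l + 1) f (x + t • w) fun _ => w) t := by
  have h1 : ContDiffAt ℝ k f (x + t • w) := hf.contDiffAt (hU.mem_nhds ht)
  have h2 : DifferentiableAt ℝ (iteratedFDeriv ℝ l f) (x + t • w) :=
    h1.differentiableAt_iteratedFDeriv (by exact_mod_cast hl)
  have h3 : HasDerivAt (fun t : ℝ => x + t • w) w t := by
    simpa using ((hasDerivAt_id t).smul_const w).const_add x
  have h4 := h2.hasFDerivAt.comp_hasDerivAt t h3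
  have h5 := (ContinuousMultilinearMap.apply ℝ (fun _ : Fin l => E) ℝ fun _ => w).hasFDerivAt.comp_hasDerivAt
    t h4
  exact h5

/-- Along segments of bounded length, functions with uniformly bounded `C^{k,1}` norms have uniform
jets of order `k + 1`. -/
lemma isJet_line {ι : Type} {k : ℕ} {f : ι → E → ℝ} {U V : ι → Set E} {x w : ι → E} {M : ℝ}
    (hU : ∀ i, IsOpen (U i)) (hf : ∀ i, ContDiffOn ℝ k (f i) (U i)) (hVU : ∀ i, V i ⊆ U i)
    (hb : ∀ i, Ck1Bound k (f i) (V i) M) (hw : ∀ i, ‖w i‖ ≤ 1)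
    (hV : ∀ i (t : ℝ), |t| ≤ 1 → x i + t • w i ∈ V i) :
    IsJet (k + 1) fun i t => f i (x i + t • w i) := by
  let G : ℕ → ι → ℝ → ℝ := fun l i t => iteratedFDeriv ℝ l (f i) (x i + t • w i) fun _ => w i
  have hwj : ∀ {l : ℕ} (j : Fin l → Fin m) i, |∏ s, w i (j s)| ≤ 1 := fun {l} j i => by
    rw [Finset.abs_prod]
    refine Finset.prod_le_one (fun _ _ => abs_nonneg _) fun s _ => ?_
    exact (PiLp.norm_apply_le (w i) (j s)).trans (hw i)
  have hwJ : ∀ {l : ℕ} (q : ℕ) (j : Fin l → Fin m), IsJet q fun i _ => ∏ s, w i (j s) :=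
    fun q j => IsJet.const q ⟨1, hwj j⟩
  have hbd : ∀ l ≤ k, IsJet 0 (G l) := fun l hl => by
    refine IsJet.congr (g := fun i t => ∑ j : Fin l → Fin m,
      (∏ s, w i (j s)) * partialDeriv j (f i) (x i + t • w i)) ?_
      fun i t _ => iteratedFDeriv_apply_const_eq_sum _ _ _ _
    exact IsJet.sum _ fun j _ => (hwJ 0 j).mul
      ⟨M, fun i t ht => (hb i).bound l hl j _ (hV i t ht)⟩
  have hlast : IsJet 1 (G k) := by
    refine IsJet.congr (g := fun i t => ∑ j : Fin k → Fin m,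
      (∏ s, w i (j s)) * partialDeriv j (f i) (x i + t • w i)) ?_
      fun i t _ => iteratedFDeriv_apply_const_eq_sum _ _ _ _
    refine IsJet.sum _ fun j _ => (hwJ 1 j).mul (IsJet.of_lipschitz (M := M) (L := |M|)
      (fun i => (hb i).bound k le_rfl j _ (hV i 0 (by simp))) fun i t ht => ?_)
    refine ((hb i).lip j _ (hV i t ht) _ (hV i 0 (by simp))).trans ?_
    have : x i + t • w i - (x i + (0 : ℝ) • w i) = t • w i := by simp
    rw [this, norm_smul, Real.norm_eq_abs]
    have h1 := hw i
    have h2 := abs_nonneg t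
    have h3 : |t| * ‖w i‖ ≤ |t| := mul_le_of_le_one_right h2 h1
    calc M * (|t| * ‖w i‖) ≤ |M| * (|t| * ‖w i‖) := by
          gcongr
          exact le_abs_self M
      _ ≤ |M| * |t| := by gcongr
  -- Descent from the top derivative along the segment, which has order `1` because it is Lipschitz;
  -- each integration gains an order.
  have key : ∀ d ≤ k, IsJet (d + 1) (G (k - d)) := fun d => by
    induction d with
    | zero => exact fun _ => hlast
    | succ d ih =>
      intro hd
      have h1 := ih (by lia)
      obtain ⟨M', hM'⟩ := hbd (k - (d + 1)) (by lia)
      refine IsJet.of_hasDerivAt (g' := G (k - d)) ⟨M', fun i => hM' i 0 (by simp)⟩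
        (fun i t ht => ?_) h1
      have := hasDerivAt_iteratedFDeriv_line (l := k - (d + 1)) (by lia) (hU i) (hf i)
        (hVU i (hV i t ht))
      rwa [show k - (d + 1) + 1 = k - d by lia] at this
  have := key k le_rfl
  refine this.congr fun i t _ => ?_
  simp [G]

/-- A pointwise Lipschitz bound with a uniform constant on a convex set is a Lipschitz bound. -/
lemma abs_sub_le_of_eventually {V : Set E} (hV : Convex ℝ V) {r : E → ℝ} (hr : ContinuousOn r V)
    {ρ L : ℝ} (hρ : 0 < ρ) (h : ∀ y ∈ V, ∀ v : E, ‖v‖ ≤ 1 →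
      ∀ᶠ t : ℝ in 𝓝 0, |r (y + t • ρ • v) - r y| ≤ L * |t|) {y z : E} (hy : y ∈ V) (hz : z ∈ V) :
    |r z - r y| ≤ L / ρ * ‖z - y‖ := by
  let c : ℝ → E := fun s => y + s • (z - y)
  have hc : ∀ s ∈ Set.Icc (0 : ℝ) 1, c s ∈ V := fun s hs => by
    have := hV.add_smul_sub_mem hy hz hs
    exact this
  have hcc : Continuous c := by fun_prop
  have hrc : ContinuousOn (fun s => r (c s)) (Set.Icc 0 1) := hr.comp hcc.continuousOn hc
  rcases eq_or_ne z y with rfl | hzy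
  · simp
  have hN : 0 < ‖z - y‖ := norm_pos_iff.2 (sub_ne_zero.2 hzy)
  let K : ℝ := L / ρ * ‖z - y‖
  let S : Set ℝ := {s | |r (c s) - r (c 0)| ≤ K * s}
  have hS : Set.Icc (0 : ℝ) 1 ⊆ S := by
    -- Continuous induction along the segment: the neighbourhoods in `h` have no uniform size, so
    -- the bound is only continued a little to the right of each point.
    refine IsClosed.Icc_subset_of_forall_exists_gt ?_ (by simp [S]) ?_
    · have : S ∩ Set.Icc 0 1 = Set.Icc 0 1 ∩ (fun s => K * s - |r (c s) - r (c 0)|) ⁻¹' Set.Ici 0 := by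
        ext s
        simp [S, and_comm]
      rw [this]
      refine ContinuousOn.preimage_isClosed_of_isClosed ?_ isClosed_Icc isClosed_Ici
      exact (continuousOn_const.mul continuousOn_id).sub (hrc.sub continuousOn_const).abs
    · rintro s ⟨hsS, hs⟩ b hb
      let v : E := ‖z - y‖⁻¹ • (z - y)
      have hv : ‖v‖ ≤ 1 := by
        simp only [v]
        rw [norm_smul, norm_inv, norm_norm, inv_mul_cancel₀ hN.ne']
      have h1 := h (c s) (hc s ⟨hs.1, hs.2.le⟩) v hv
      have ht : Filter.Tendsto (fun u : ℝ => (u - s) * (‖z - y‖ / ρ)) (𝓝[>] s) (𝓝 0) := by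
        have : ContinuousAt (fun u : ℝ => (u - s) * (‖z - y‖ / ρ)) s := by fun_prop
        have h2 : Filter.Tendsto (fun u : ℝ => (u - s) * (‖z - y‖ / ρ)) (𝓝 s) (𝓝 0) := by
          simpa [ContinuousAt] using this
        exact h2.mono_left nhdsWithin_le_nhds
      obtain ⟨u, hu, hub⟩ := ((ht.eventually h1).and (Ioc_mem_nhdsGT hb)).exists
      refine ⟨u, ?_, hub⟩
      -- The time `(u - s) * (‖z - y‖ / ρ)` along `ρ • v` is the one that leads from `c s` to `c u`.
      have e : c s + ((u - s) * (‖z - y‖ / ρ)) • ρ • v = c u := by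
        simp only [c, v, smul_smul, add_assoc, ← add_smul]
        congr 2
        field_simp
        ring
      have hus : 0 ≤ u - s := sub_nonneg.2 hub.1.le
      have hpos : 0 ≤ (u - s) * (‖z - y‖ / ρ) := mul_nonneg hus (by positivity)
      rw [e, abs_of_nonneg hpos] at hu
      change |r (c u) - r (c 0)| ≤ K * u
      change |r (c s) - r (c 0)| ≤ K * s at hsS
      calc _ ≤ |r (c u) - r (c s)| + |r (c s) - r (c 0)| := abs_sub_le _ _ _
        _ ≤ L * ((u - s) * (‖z - y‖ / ρ)) + K * s := add_le_add hu hsS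
        _ = K * u := by simp only [K]; ring
  have := hS (Set.right_mem_Icc.2 zero_le_one)
  simpa [S, c, K] using this

/-- Truncation of the real line to `[-1, 1]`. -/
noncomputable def clamp (t : ℝ) : ℝ := max (-1) (min t 1)

lemma abs_clamp_le (t : ℝ) : |clamp t| ≤ 1 :=
  abs_le.2 ⟨le_max_left _ _, max_le (by norm_num) (min_le_right _ _)⟩

lemma clamp_of_abs_le {t : ℝ} (ht : |t| ≤ 1) : clamp t = t := by
  have := abs_le.1 ht
  rw [clamp, min_eq_left this.2, max_eq_right this.1]

lemma clamp_zero : clamp 0 = 0 := clamp_of_abs_le (by simp)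

lemma continuous_clamp : Continuous clamp := by
  unfold clamp
  fun_prop

/-- Jets are tested only on `[-1, 1]`, but real-rootedness is required for all `t`; `clamp` keeps
the point in `V i`. -/
lemma jetFamily_line {ι : Type} {n k : ℕ} {a : ι → Fin n → E → ℝ} {U V : ι → Set E}
    {x w : ι → E} {M : ℝ} (hU : ∀ i, IsOpen (U i)) (ha : ∀ i j, ContDiffOn ℝ k (a i j) (U i))
    (hVU : ∀ i, V i ⊆ U i) (hb : ∀ i j, Ck1Bound k (a i j) (V i) M) (hw : ∀ i, ‖w i‖ ≤ 1)
    (hV : ∀ i (t : ℝ), |t| ≤ 1 → x i + t • w i ∈ V i)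
    (hs : ∀ i, ∀ y ∈ V i, (monicPoly fun j => a i j y).Splits) :
    JetFamily n (k + 1) fun i t => monicPoly fun j => a i j (x i + clamp t • w i) := by
  refine ⟨fun i t => monic_monicPoly _, fun i t => natDegree_monicPoly _,
    fun i t => hs i _ (hV i _ (abs_clamp_le t)), fun j => ?_⟩
  simp only [coeff_monicPoly]
  split_ifs with h1 h2
  · exact (isJet_line hU (fun i => ha i _) hVU (fun i => hb i _) hw hV).congr fun i t ht => by
      rw [clamp_of_abs_le ht]
  · exact IsJet.const' _ 1
  · exact IsJet.const' _ 0

lemma rootGerm_line {ι : Type} {n : ℕ} {a : ι → Fin n → E → ℝ} {U V : ι → Set E}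
    {x w : ι → E} {r : ι → E → ℝ} (hU : ∀ i, IsOpen (U i)) (hVU : ∀ i, V i ⊆ U i)
    (hV : ∀ i (t : ℝ), |t| ≤ 1 → x i + t • w i ∈ V i)
    (hr : ∀ i, IsContinuousRoot (U i) (a i) (r i)) :
    RootGerm (fun i t => monicPoly fun j => a i j (x i + clamp t • w i))
      fun i t => r i (x i + clamp t • w i) := by
  refine ⟨fun i => Filter.Eventually.of_forall fun t =>
    (hr i).2 _ (hVU i (hV i _ (abs_clamp_le t))), fun i => ?_⟩
  have h1 : ContinuousAt (r i) (x i + clamp 0 • w i) :=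
    (hr i).1.continuousAt ((hU i).mem_nhds (hVU i (hV i _ (abs_clamp_le 0))))
  have h2 : ContinuousAt (fun t : ℝ => x i + clamp t • w i) 0 := by
    have := continuous_clamp
    fun_prop
  exact ContinuousAt.comp (g := r i) h1 h2

lemma LipAtZero.eventually_line {ι : Type} {x w : ι → E} {r : ι → E → ℝ}
    (h : LipAtZero fun i t => r i (x i + clamp t • w i)) :
    ∃ L : ℝ, ∀ i, ∀ᶠ t : ℝ in 𝓝 0, |r i (x i + t • w i) - r i (x i)| ≤ L * |t| := by
  obtain ⟨L, hL⟩ := h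
  refine ⟨L, fun i => ?_⟩
  filter_upwards [hL i, eventually_abs_le_one] with t h1 h2
  rwa [clamp_of_abs_le h2, clamp_zero, zero_smul, add_zero] at h1

end geometry

/-! ### Local Lipschitz continuity and uniform constants -/

section theorems

variable {m n : ℕ}

lemma continuousAt_partialDeriv {k l : ℕ} (hl : l ≤ k) {f : EuclideanSpace ℝ (Fin m) → ℝ}
    {x : EuclideanSpace ℝ (Fin m)} (hf : ContDiffAt ℝ k f x) (j : Fin l → Fin m) :
    ContinuousAt (partialDeriv j f) x := by
  have h1 : ContinuousAt (iteratedFDeriv ℝ l f) x := by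
    have h2 : ContDiffAt ℝ (0 : ℕ) (iteratedFDeriv ℝ l f) x :=
      hf.iteratedFDeriv_right (by exact_mod_cast (by lia : 0 + l ≤ k))
    exact h2.continuousAt
  exact (ContinuousMultilinearMap.apply ℝ (fun _ : Fin l => EuclideanSpace ℝ (Fin m)) ℝ
    fun s => EuclideanSpace.single (j s) (1 : ℝ)).continuous.continuousAt.comp h1

lemma IsCk1On.exists_ck1Bound {k : ℕ} {f : EuclideanSpace ℝ (Fin m) → ℝ}
    {U : Set (EuclideanSpace ℝ (Fin m))} (hU : IsOpen U) (hf : IsCk1On k f U)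
    {x : EuclideanSpace ℝ (Fin m)} (hx : x ∈ U) :
    ∃ M : ℝ, ∃ V ∈ 𝓝 x, Ck1Bound k f V M := by
  have hfx : ContDiffAt ℝ k f x := hf.1.contDiffAt (hU.mem_nhds hx)
  have hK : ∀ j : Fin k → Fin m, ∃ K : ℝ≥0, ∃ V ∈ 𝓝 x, LipschitzOnWith K (partialDeriv j f) V :=
    fun j => by
      obtain ⟨K, V, hV, hL⟩ := hf.2 j hx
      rw [hU.nhdsWithin_eq hx] at hV
      exact ⟨K, V, hV, hL⟩
  choose K V hV hL using hK
  let A : ∀ l : ℕ, (Fin l → Fin m) → ℝ := fun l j => |partialDeriv j f x| + 1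
  let M₁ : ℝ := ∑ l ∈ Finset.range (k + 1), ∑ j, A l j
  have hA : ∀ l (j : Fin l → Fin m), 0 ≤ A l j := fun l j => by positivity
  have hM₁ : ∀ l ≤ k, ∀ j, A l j ≤ M₁ := fun l hl j =>
    (Finset.single_le_sum (f := A l) (fun _ _ => hA _ _) (Finset.mem_univ j)).trans
      (Finset.single_le_sum (f := fun l => ∑ j, A l j) (fun l _ => Finset.sum_nonneg fun _ _ => hA _ _)
        (Finset.mem_range.2 (Nat.lt_succ_of_le hl)))
  let M₂ : ℝ := ∑ j, (K j : ℝ)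
  have hM₂ : ∀ j, (K j : ℝ) ≤ M₂ := fun j =>
    Finset.single_le_sum (f := fun j => (K j : ℝ)) (fun _ _ => (K _).coe_nonneg) (Finset.mem_univ j)
  have hev : ∀ᶠ y in 𝓝 x, ∀ l ∈ Finset.range (k + 1), ∀ j : Fin l → Fin m,
      |partialDeriv j f y| ≤ A l j := by
    refine (Finset.eventually_all _).2 fun l hl => Filter.eventually_all.2 fun j => ?_
    have := (continuousAt_partialDeriv (Nat.lt_succ_iff.1 (Finset.mem_range.1 hl)) hfx j).abs
    filter_upwards [this.eventually_lt continuousAt_const (lt_add_one |partialDeriv j f x|)]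
      with y hy using hy.le
  have hVs : ∀ᶠ y in 𝓝 x, ∀ j : Fin k → Fin m, y ∈ V j := Filter.eventually_all.2 hV
  refine ⟨max M₁ M₂, _, hev.and hVs, fun l hl j y hy => ?_, fun j y hy z hz => ?_⟩
  · exact (hy.1 l (Finset.mem_range.2 (Nat.lt_succ_of_le hl)) j).trans
      ((hM₁ l hl j).trans (le_max_left _ _))
  · have := (hL j).dist_le_mul y (hy.2 j) z (hz.2 j)
    rw [Real.dist_eq, dist_eq_norm] at this
    exact this.trans (mul_le_mul_of_nonneg_right ((hM₂ j).trans (le_max_right _ _)) (norm_nonneg _))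

/-- The factor `4` leaves room: when roots move by at most `ε`, those coming from `c` stay within
`ε` of it and the others stay at least `3 * ε` away, so a gap of `2 * ε` remains. -/
lemma exists_isolating_radius (s : Multiset ℝ) (c : ℝ) :
    ∃ ε > 0, ∀ x ∈ s, x ≠ c → 4 * ε ≤ |x - c| := by
  induction s using Multiset.induction with
  | empty => exact ⟨1, one_pos, by simp⟩
  | cons a s ih =>
    obtain ⟨ε, hε, h⟩ := ih
    by_cases ha : a = c
    · refine ⟨ε, hε, fun x hx hxc => ?_⟩
      rcases Multiset.mem_cons.1 hx with rfl | hx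
      · exact absurd ha hxc
      · exact h x hx hxc
    · have ha' : 0 < |a - c| := abs_pos.2 (sub_ne_zero.2 ha)
      refine ⟨min ε (|a - c| / 4), lt_min hε (by positivity), fun x hx hxc => ?_⟩
      rcases Multiset.mem_cons.1 hx with rfl | hx
      · linarith [min_le_right ε (|x - c| / 4)]
      · linarith [min_le_left ε (|a - c| / 4), h x hx hxc]

/-- Continuous roots are locally Lipschitz if the coefficients are of class `C^{p-1,1}`, where `p`
bounds the multiplicities. -/
lemma locallyLipschitzOn_root {p : ℕ} (hp : 1 ≤ p) {U : Set (EuclideanSpace ℝ (Fin m))}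
    {a : Fin n → EuclideanSpace ℝ (Fin m) → ℝ} (hU : IsOpen U)
    (ha : IsHyperbolicFamily (p - 1) U a)
    (hmult : ∀ x ∈ U, ∀ z : ℝ, (monicPoly fun i => a i x).rootMultiplicity z ≤ p)
    {r : EuclideanSpace ℝ (Fin m) → ℝ} (hr : IsContinuousRoot U a r) : LocallyLipschitzOn U r := by
  intro x₀ hx₀
  choose M V hV hM using fun i => (ha.1 i).exists_ck1Bound hU hx₀
  let N : ℝ := ∑ i, |M i|
  have hMN : ∀ i, M i ≤ N := fun i => (le_abs_self _).trans
    (Finset.single_le_sum (f := fun i => |M i|) (fun _ _ => abs_nonneg _) (Finset.mem_univ i))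
  let P : EuclideanSpace ℝ (Fin m) → ℝ[X] := fun x => monicPoly fun i => a i x
  have mP : ∀ x, (P x).Monic := fun x => monic_monicPoly _
  have dP : ∀ x, (P x).natDegree = n := fun x => natDegree_monicPoly _
  have sP : ∀ x ∈ U, (P x).Splits := fun x hx => (ha.2 x hx).splits
  obtain ⟨ε, hε, hiso⟩ := exists_isolating_radius (P x₀).roots (r x₀)
  obtain ⟨B, hB⟩ : ∃ B : ℝ, ∀ k, |(P x₀).coeff k| + 1 ≤ B := by
    refine ⟨∑ k ∈ Finset.range (n + 1), |(P x₀).coeff k| + 1, fun k => ?_⟩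
    gcongr
    by_cases hk : k < n + 1
    · exact Finset.single_le_sum (f := fun k => |(P x₀).coeff k|) (fun _ _ => abs_nonneg _)
        (Finset.mem_range.2 hk)
    · rw [coeff_eq_zero_of_natDegree_lt (by rw [dP]; lia), abs_zero]
      exact Finset.sum_nonneg fun _ _ => abs_nonneg _
  obtain ⟨η, hη, hrel⟩ := exists_rel_roots n (B := B) hε
  have hcoeff : ∀ᶠ y in 𝓝 x₀, ∀ k ∈ Finset.range n,
      |(P x₀).coeff k - (P y).coeff k| ≤ min η 1 := by
    refine (Finset.eventually_all _).2 fun k hk => ?_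
    have hc : ContinuousAt (fun y => (P y).coeff k) x₀ := by
      have hk' := Finset.mem_range.1 hk
      simp only [P, coeff_monicPoly, dif_pos hk']
      exact ((ha.1 _).1.continuousOn.continuousAt (hU.mem_nhds hx₀))
    have := Metric.tendsto_nhds.1 hc (min η 1) (lt_min hη one_pos)
    filter_upwards [this] with y hy
    rw [abs_sub_comm]
    exact hy.le
  have hrc : ∀ᶠ y in 𝓝 x₀, |r y - r x₀| ≤ ε := by
    have := Metric.tendsto_nhds.1 (hr.1.continuousAt (hU.mem_nhds hx₀)) ε hε
    filter_upwards [this] with y hy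
    exact hy.le
  have hVall : ∀ᶠ y in 𝓝 x₀, ∀ i, y ∈ V i := Filter.eventually_all.2 hV
  have hUev : ∀ᶠ y in 𝓝 x₀, y ∈ U := hU.mem_nhds hx₀
  obtain ⟨R, hR, hball⟩ := Metric.eventually_nhds_iff_ball.1
    ((hUev.and hVall).and (hcoeff.and hrc))
  let ρ : ℝ := min (R / 2) 1
  have hρ : 0 < ρ := lt_min (by positivity) one_pos
  have hρR : ρ ≤ R / 2 := min_le_left _ _
  -- One index for each base point near `x₀` and each direction, so that a single constant serves
  -- all of them. Base points are kept in the half ball so that the segments stay in the whole one.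
  let ι : Type := {yv : EuclideanSpace ℝ (Fin m) × EuclideanSpace ℝ (Fin m) //
    yv.1 ∈ Metric.ball x₀ (R / 2) ∧ ‖yv.2‖ ≤ 1}
  have hline : ∀ (i : ι) (t : ℝ), |t| ≤ 1 → i.1.1 + t • ρ • i.1.2 ∈ Metric.ball x₀ R :=
    fun i t ht => by
      have h1 : dist i.1.1 x₀ < R / 2 := i.2.1
      have h2 := i.2.2
      rw [Metric.mem_ball]
      have h3 : ‖t • ρ • i.1.2‖ ≤ R / 2 := by
        rw [norm_smul, norm_smul, Real.norm_eq_abs, Real.norm_eq_abs, abs_of_pos hρ]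
        calc |t| * (ρ * ‖i.1.2‖) ≤ 1 * (R / 2 * 1) := by gcongr
          _ = R / 2 := by ring
      have h4 : dist (i.1.1 + t • ρ • i.1.2) i.1.1 ≤ R / 2 := by
        rw [dist_eq_norm, add_sub_cancel_left]
        exact h3
      linarith [dist_triangle (i.1.1 + t • ρ • i.1.2) i.1.1 x₀]
  have hw : ∀ i : ι, ‖ρ • i.1.2‖ ≤ 1 := fun i => by
    rw [norm_smul, Real.norm_eq_abs, abs_of_pos hρ]
    exact mul_le_one₀ (min_le_right _ _) (norm_nonneg _) i.2.2
  have hbU : Metric.ball x₀ R ⊆ U := fun y hy => (hball y hy).1.1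
  have hJ : JetFamily n p fun (i : ι) t => monicPoly fun j => a j (i.1.1 + clamp t • ρ • i.1.2) := by
    have := jetFamily_line (ι := ι) (a := fun _ => a) (k := p - 1) (U := fun _ => U)
      (V := fun _ => Metric.ball x₀ R) (x := fun i => i.1.1) (w := fun i => ρ • i.1.2) (M := N)
      (fun _ => hU) (fun _ j => (ha.1 j).1) (fun _ => hbU)
      (fun _ j => (hM j).mono (fun y hy => (hball y hy).1.2 j) (hMN j)) hw hline
      (fun _ y hy => sP y (hbU hy))
    rwa [Nat.sub_add_cancel hp] at this
  have hG := rootGerm_line (ι := ι) (a := fun _ => a) (U := fun _ => U)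
    (V := fun _ => Metric.ball x₀ R) (x := fun i => i.1.1) (w := fun i => ρ • i.1.2)
    (r := fun _ => r) (fun _ => hU) (fun _ => hbU) hline fun _ => hr
  have hmem : ∀ i : ι, i.1.1 ∈ Metric.ball x₀ R := fun i =>
    Metric.ball_subset_ball (by linarith) i.2.1
  have hrel' : ∀ y ∈ Metric.ball x₀ R,
      Multiset.Rel (fun x y => |x - y| ≤ ε) (P x₀).roots (P y).roots := fun y hy => by
    obtain ⟨⟨hyU, -⟩, hyc, -⟩ := hball y hy
    have hyc' : ∀ k < n, |(P x₀).coeff k - (P y).coeff k| ≤ min η 1 := fun k hk =>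
      hyc k (Finset.mem_range.2 hk)
    refine hrel _ _ (mP _) (mP _) (dP _) (dP _) (sP _ hx₀) (sP _ hyU)
      (fun k _ => by linarith [hB k]) (fun k hk => ?_) fun k hk => (hyc' k hk).trans (min_le_left _ _)
    have h1 := (hyc' k hk).trans (min_le_right _ _)
    have h2 := abs_sub_abs_le_abs_sub ((P y).coeff k) ((P x₀).coeff k)
    rw [abs_sub_comm] at h2
    linarith [hB k]
  have hnear : ∀ y, ∀ x ∈ (P x₀).roots, |x - y| ≤ ε → (x = r x₀ ↔ |y - r x₀| ≤ ε) ∧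
      (x ≠ r x₀ → 3 * ε ≤ |y - r x₀|) := fun y x hx hxy => by
    have h3 : x ≠ r x₀ → 3 * ε ≤ |y - r x₀| := fun hne => by
      have h1 := hiso x hx hne
      have h2 := abs_sub_le x y (r x₀)
      linarith
    refine ⟨⟨fun h => by rw [← h, abs_sub_comm]; exact hxy, fun h => ?_⟩, h3⟩
    by_contra hne
    linarith [h3 hne]
  -- The cluster near `r x₀` has as many roots as the multiplicity of `r x₀` at `x₀`, hence at most
  -- `p`, so jets of order `p = (p - 1) + 1` suffice whatever the degree `n`.
  have hL := lipAtZero_of_cluster hp hJ hG le_rfl (fun d _ => rootsLipschitz d)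
    (fun _ => {z | |z - r x₀| ≤ ε}) (g := 2 * ε) (by positivity)
    (fun i => by
      simp only [clamp_zero, zero_smul, add_zero]
      exact (hball _ (hmem i)).2.2)
    (fun i x hx y hy hxS hyS => by
      simp only [clamp_zero, zero_smul, add_zero] at hx hy
      obtain ⟨y', hy', hyy'⟩ :=
        Multiset.exists_mem_of_rel_of_mem (Multiset.rel_flip.2 (hrel' _ (hmem i))) hy
      have h1 := hnear y y' hy' hyy'
      have h2 := h1.2 fun h => hyS (h1.1.1 h)
      have h3 : |x - r x₀| ≤ ε := hxS
      have h4 := abs_sub_le y x (r x₀)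
      rw [abs_sub_comm y x] at h4
      linarith)
    (fun i => by
      classical
      simp only [clamp_zero, zero_smul, add_zero]
      have h1 := (hrel' _ (hmem i)).card_filter_eq (fun x => x = r x₀)
        (fun y => y ∈ {z | |z - r x₀| ≤ ε}) fun x hx y _ hxy => (hnear y x hx hxy).1
      have h2 := hmult x₀ hx₀ (r x₀)
      rw [← count_roots, ← Multiset.card_replicate (Multiset.count _ _) (r x₀),
        ← Multiset.filter_eq'] at h2
      refine le_trans (le_of_eq ?_) h2
      convert h1.symm)
  obtain ⟨L, hL⟩ := hL.eventually_line (x := fun i : ι => i.1.1) (w := fun i => ρ • i.1.2)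
    (r := fun _ => r)
  refine ⟨(|L| / ρ).toNNReal, Metric.ball x₀ (R / 2),
    mem_nhdsWithin_of_mem_nhds (Metric.ball_mem_nhds _ (by positivity)), ?_⟩
  refine LipschitzOnWith.of_dist_le_mul fun y hy z hz => ?_
  rw [Real.dist_eq, dist_eq_norm, Real.coe_toNNReal _ (by positivity)]
  refine abs_sub_le_of_eventually (convex_ball x₀ (R / 2))
    (hr.1.mono ((Metric.ball_subset_ball (by linarith)).trans hbU)) hρ (fun u hu v hv => ?_) hz hy
  filter_upwards [hL ⟨(u, v), hu, hv⟩] with t ht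
  exact ht.trans (mul_le_mul_of_nonneg_right (le_abs_self _) (abs_nonneg _))

lemma ck1Bound_of_ck1Norm_le {k : ℕ} {K : Set (EuclideanSpace ℝ (Fin m))}
    {f : EuclideanSpace ℝ (Fin m) → ℝ} {M : ℝ} (hM : 0 ≤ M)
    (h : ck1Norm k K f ≤ ENNReal.ofReal M) : Ck1Bound k f K M := by
  have h1 : ckNorm k K f ≤ ENNReal.ofReal M := le_self_add.trans h
  have h2 : ⨆ j : Fin k → Fin m, lipConst K (partialDeriv j f) ≤ ENNReal.ofReal M :=
    le_add_self.trans h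
  refine ⟨fun l hl j y hy => ?_, fun j y hy z hz => ?_⟩
  · have h3 : ‖partialDeriv j f y‖ₑ ≤ ckNorm k K f :=
      le_iSup_of_le l <| le_iSup_of_le hl <| le_iSup_of_le j <| le_iSup_of_le y <|
        le_iSup_of_le hy le_rfl
    have h4 := h3.trans h1
    rw [← ofReal_norm, ENNReal.ofReal_le_ofReal_iff hM] at h4
    exact h4
  · rcases eq_or_ne y z with rfl | hyz
    · simp
    have h3 : edist (partialDeriv j f y) (partialDeriv j f z) / edist y z ≤ ENNReal.ofReal M :=
      le_trans (le_iSup_of_le y <| le_iSup_of_le hy <| le_iSup_of_le z <| le_iSup_of_le hz <|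
        le_iSup (fun _ : y ≠ z => edist (partialDeriv j f y) (partialDeriv j f z) / edist y z) hyz)
        ((le_iSup _ j).trans h2)
    rw [ENNReal.div_le_iff (by simpa [edist_eq_zero] using hyz) (edist_ne_top _ _), edist_dist,
      edist_dist, ← ENNReal.ofReal_mul hM, ENNReal.ofReal_le_ofReal_iff (by positivity)] at h3
    rwa [Real.dist_eq, dist_eq_norm] at h3

lemma lipConst_le {K : Set (EuclideanSpace ℝ (Fin m))} {f : EuclideanSpace ℝ (Fin m) → ℝ} {M : ℝ}
    (hM : 0 ≤ M) (h : ∀ x ∈ K, ∀ y ∈ K, |f x - f y| ≤ M * ‖x - y‖) :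
    lipConst K f ≤ ENNReal.ofReal M := by
  refine iSup_le fun x => iSup_le fun hx => iSup_le fun y => iSup_le fun hy => iSup_le fun hxy => ?_
  rw [ENNReal.div_le_iff (by simpa [edist_eq_zero] using hxy) (edist_ne_top _ _), edist_dist,
    edist_dist, ← ENNReal.ofReal_mul hM, ENNReal.ofReal_le_ofReal_iff (by positivity),
    Real.dist_eq, dist_eq_norm]
  exact h x hx y hy

lemma monicPoly_scaleRoots (a : Fin n → ℝ) (s : ℝ) :
    (monicPoly a).scaleRoots s = monicPoly fun i => s ^ (i.val + 1) * a i := by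
  ext k
  rw [coeff_scaleRoots, natDegree_monicPoly, coeff_monicPoly, coeff_monicPoly]
  split_ifs with h1 h2
  · rw [mul_comm]
    congr 2
    simp only []
    lia
  · simp [h2]
  · simp

/-- Uniform Lipschitz bound for the roots of families with coefficients of norm at most one. -/
lemma exists_lipschitz_of_ck1Bound_one (hn : 1 ≤ n) {U₀ U₁ : Set (EuclideanSpace ℝ (Fin m))}
    (h01 : CompactlyInside U₀ U₁) : ∃ K : ℝ, 0 < K ∧ ∀ (U : Set (EuclideanSpace ℝ (Fin m)))
      (a : Fin n → EuclideanSpace ℝ (Fin m) → ℝ) (r : EuclideanSpace ℝ (Fin m) → ℝ),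
      IsOpen U → U₁ ⊆ U → (∀ i, ContDiffOn ℝ (n - 1 : ℕ) (a i) U) →
      (∀ i, Ck1Bound (n - 1) (a i) U₁ 1) → (∀ x ∈ U, (monicPoly fun i => a i x).Splits) →
      IsContinuousRoot U a r → ∀ x ∈ U₀, ∀ y ∈ U₀, |r x - r y| ≤ K * ‖x - y‖ := by
  obtain ⟨δ, hδ, hδU⟩ := h01.1.exists_thickening_subset_open isOpen_interior h01.2
  have hδU₁ : Metric.thickening δ (closure U₀) ⊆ U₁ := hδU.trans interior_subset
  let ρ : ℝ := min (δ / 2) 1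
  have hρ : 0 < ρ := lt_min (by positivity) one_pos
  have hρδ : ρ ≤ δ / 2 := min_le_left _ _
  let Good : Set (EuclideanSpace ℝ (Fin m)) → (Fin n → EuclideanSpace ℝ (Fin m) → ℝ) →
      (EuclideanSpace ℝ (Fin m) → ℝ) → Prop := fun U a r =>
    IsOpen U ∧ U₁ ⊆ U ∧ (∀ i, ContDiffOn ℝ (n - 1 : ℕ) (a i) U) ∧
      (∀ i, Ck1Bound (n - 1) (a i) U₁ 1) ∧ (∀ x ∈ U, (monicPoly fun i => a i x).Splits) ∧
      IsContinuousRoot U a r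
  -- The index runs over all admissible domains, coefficients and roots as well as base points and
  -- directions; hence the constant depends on none of them.
  let ι : Type := {d : (Set (EuclideanSpace ℝ (Fin m)) ×
      (Fin n → EuclideanSpace ℝ (Fin m) → ℝ) × (EuclideanSpace ℝ (Fin m) → ℝ)) ×
      EuclideanSpace ℝ (Fin m) × EuclideanSpace ℝ (Fin m) //
    Good d.1.1 d.1.2.1 d.1.2.2 ∧ d.2.1 ∈ Metric.thickening (δ / 2) (closure U₀) ∧ ‖d.2.2‖ ≤ 1}
  have hline : ∀ (i : ι) (t : ℝ), |t| ≤ 1 → i.1.2.1 + t • ρ • i.1.2.2 ∈ U₁ := fun i t ht => by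
    obtain ⟨z, hz, hzd⟩ := Metric.mem_thickening_iff.1 i.2.2.1
    refine hδU₁ (Metric.mem_thickening_iff.2 ⟨z, hz, ?_⟩)
    have h2 := i.2.2.2
    have h3 : ‖t • ρ • i.1.2.2‖ ≤ δ / 2 := by
      rw [norm_smul, norm_smul, Real.norm_eq_abs, Real.norm_eq_abs, abs_of_pos hρ]
      calc |t| * (ρ * ‖i.1.2.2‖) ≤ 1 * (δ / 2 * 1) := by gcongr
        _ = δ / 2 := by ring
    have h4 : dist (i.1.2.1 + t • ρ • i.1.2.2) i.1.2.1 ≤ δ / 2 := by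
      rw [dist_eq_norm, add_sub_cancel_left]
      exact h3
    linarith [dist_triangle (i.1.2.1 + t • ρ • i.1.2.2) i.1.2.1 z]
  have hw : ∀ i : ι, ‖ρ • i.1.2.2‖ ≤ 1 := fun i => by
    rw [norm_smul, Real.norm_eq_abs, abs_of_pos hρ]
    exact mul_le_one₀ (min_le_right _ _) (norm_nonneg _) i.2.2.2
  have hJ := jetFamily_line (ι := ι) (a := fun i => i.1.1.2.1) (k := n - 1) (U := fun i => i.1.1.1)
    (V := fun _ => U₁) (x := fun i => i.1.2.1) (w := fun i => ρ • i.1.2.2) (M := 1)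
    (fun i => i.2.1.1) (fun i => i.2.1.2.2.1) (fun i => i.2.1.2.1) (fun i => i.2.1.2.2.2.1) hw hline
    (fun i y hy => i.2.1.2.2.2.2.1 y (i.2.1.2.1 hy))
  rw [Nat.sub_add_cancel hn] at hJ
  have hG := rootGerm_line (ι := ι) (a := fun i => i.1.1.2.1) (U := fun i => i.1.1.1)
    (V := fun _ => U₁) (x := fun i => i.1.2.1) (w := fun i => ρ • i.1.2.2)
    (r := fun i => i.1.1.2.2) (fun i => i.2.1.1) (fun i => i.2.1.2.1) hline
    (fun i => i.2.1.2.2.2.2.2)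
  obtain ⟨L, hL⟩ := (rootsLipschitz n ι _ _ hJ hG).eventually_line (x := fun i : ι => i.1.2.1)
    (w := fun i => ρ • i.1.2.2) (r := fun i => i.1.1.2.2)
  -- `U₀` need not be convex. The first term serves pairs closer than `δ / 2`, joined inside a ball;
  -- the second serves distant pairs, through the bound `1 + n` for the roots.
  refine ⟨|L| / ρ + 2 * (1 + n) / (δ / 2), by positivity,
    fun U a r hU h1U ha hb hs hr x hx y hy => ?_⟩
  have hsub : Metric.thickening (δ / 2) (closure U₀) ⊆ U₁ :=
    (Metric.thickening_mono (by linarith) _).trans hδU₁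
  rcases lt_or_ge (dist x y) (δ / 2) with hxy | hxy
  · have hball : Metric.ball y (δ / 2) ⊆ Metric.thickening (δ / 2) (closure U₀) := fun z hz =>
      Metric.mem_thickening_iff.2 ⟨y, subset_closure hy, hz⟩
    have h1 := abs_sub_le_of_eventually (convex_ball y (δ / 2))
      (hr.1.mono (hball.trans (hsub.trans h1U))) (L := |L|) hρ (fun u hu v hv => by
        filter_upwards [hL ⟨((U, a, r), u, v), ⟨hU, h1U, ha, hb, hs, hr⟩, hball hu, hv⟩] with t ht
        exact ht.trans (mul_le_mul_of_nonneg_right (le_abs_self _) (abs_nonneg _)))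
      (Metric.mem_ball_self (by positivity)) (Metric.mem_ball.2 hxy)
    refine h1.trans (mul_le_mul_of_nonneg_right ?_ (norm_nonneg _))
    have : 0 ≤ 2 * (1 + (n : ℝ)) / (δ / 2) := by positivity
    linarith
  · have hr1 : ∀ z ∈ U₀, |r z| ≤ 1 + n := fun z hz => by
      have hz1 : z ∈ U₁ := hsub (Metric.self_subset_thickening (by positivity) _ (subset_closure hz))
      have := (monic_monicPoly fun i => a i z).abs_le_of_isRoot (B := 1) (fun k hk => by
        rw [natDegree_monicPoly] at hk
        rw [coeff_monicPoly, dif_pos hk]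
        have := (hb ⟨n - 1 - k, by lia⟩).bound 0 (Nat.zero_le _) Fin.elim0 z hz1
        simpa [partialDeriv] using this) (hr.2 z (h1U hz1))
      rwa [natDegree_monicPoly, mul_one] at this
    rw [dist_eq_norm] at hxy
    have h2 : |r x - r y| ≤ 2 * (1 + n) := by
      have := abs_sub (r x) (r y)
      linarith [hr1 x hx, hr1 y hy]
    have h3 : 2 * (1 + (n : ℝ)) ≤ 2 * (1 + n) / (δ / 2) * ‖x - y‖ := by
      rw [div_mul_eq_mul_div, le_div_iff₀ (by positivity)]
      gcongr
    have h4 : 0 ≤ |L| / ρ * ‖x - y‖ := by positivity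
    linarith

end theorems

/-- Multiparameter Bronshtein theorem. In the first part `p` is any upper bound `≥ 1` for the
multiplicities of the roots over `U`, for instance the maximal multiplicity. The second part is the
case `p = n`, where the bound on the multiplicities holds automatically; its constants depend only
on `m`, `n`, `U₀`, `U₁`. -/
theorem theorem2 (m n : ℕ) (hn : 1 ≤ n) :
    (∀ (p : ℕ) (U : Set (EuclideanSpace ℝ (Fin m)))
        (a : Fin n → EuclideanSpace ℝ (Fin m) → ℝ),
      1 ≤ p → IsOpen U → IsHyperbolicFamily (p - 1) U a →
      (∀ x ∈ U, ∀ z : ℝ, (monicPoly fun i => a i x).rootMultiplicity z ≤ p) →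
      ∀ r : EuclideanSpace ℝ (Fin m) → ℝ, IsContinuousRoot U a r → LocallyLipschitzOn U r) ∧
    (∀ U₀ U₁ : Set (EuclideanSpace ℝ (Fin m)), CompactlyInside U₀ U₁ →
      ∃ c c' : ℝ≥0, ∀ (U : Set (EuclideanSpace ℝ (Fin m)))
          (a : Fin n → EuclideanSpace ℝ (Fin m) → ℝ),
        IsOpen U → CompactlyInside U₁ U → IsHyperbolicFamily (n - 1) U a →
        ∀ r : EuclideanSpace ℝ (Fin m) → ℝ, IsContinuousRoot U a r →
          lipConst U₀ r ≤
              c * ⨆ i : Fin n, ck1Norm (n - 1) (closure U₁) (a i) ^ (1 / ((i.val : ℝ) + 1)) ∧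
          c * (⨆ i : Fin n, ck1Norm (n - 1) (closure U₁) (a i) ^ (1 / ((i.val : ℝ) + 1))) ≤
              c' * (1 + ⨆ i : Fin n, ck1Norm (n - 1) (closure U₁) (a i))) := by
  refine ⟨fun p U a hp hU ha hmult r hr => locallyLipschitzOn_root hp hU ha hmult hr,
    fun U₀ U₁ h01 => ?_⟩
  obtain ⟨K, hK, H⟩ := exists_lipschitz_of_ck1Bound_one hn h01
  refine ⟨K.toNNReal, K.toNNReal, fun U a hU h1U ha r hr => ⟨?_, ?_⟩⟩
  · set A := ⨆ i : Fin n, ck1Norm (n - 1) (closure U₁) (a i) ^ (1 / ((i.val : ℝ) + 1))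
    change _ ≤ ENNReal.ofReal K * A
    rcases eq_or_ne A ⊤ with hT | hT
    · rw [hT, ENNReal.mul_top (by simpa using hK)]
      exact le_top
    rw [← ENNReal.ofReal_toReal hT, ← ENNReal.ofReal_mul hK.le]
    have hUU : closure U₁ ⊆ U := h1U.2.trans interior_subset
    refine lipConst_le (by positivity) fun x hx y hy => ?_
    -- Scaling divides by `B`, and `A` may be zero; so the bound is shown for every `B > A` and then
    -- `B` tends to `A`.
    have key : ∀ B : ℝ, A.toReal < B → |r x - r y| ≤ K * B * ‖x - y‖ := fun B hB => by
      have hB0 : 0 < B := ENNReal.toReal_nonneg.trans_lt hB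
      have hnorm : ∀ i, ck1Norm (n - 1) (closure U₁) (a i) ≤ ENNReal.ofReal (B ^ (i.val + 1)) :=
        fun i => by
          have h1 : ck1Norm (n - 1) (closure U₁) (a i) ^ (1 / ((i.val : ℝ) + 1)) ≤
              ENNReal.ofReal B :=
            (le_iSup (fun i : Fin n =>
              ck1Norm (n - 1) (closure U₁) (a i) ^ (1 / ((i.val : ℝ) + 1))) i).trans
              (ENNReal.le_ofReal_iff_toReal_le hT hB0.le |>.2 hB.le)
          rw [one_div, ENNReal.rpow_inv_le_iff (by positivity)] at h1
          refine h1.trans (le_of_eq ?_)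
          rw [ENNReal.ofReal_pow hB0.le, ← ENNReal.rpow_natCast]
          push_cast
          rfl
      have hpos : ∀ i : Fin n, 0 < B⁻¹ ^ (i.val + 1) := fun i => by positivity
      -- Dividing the roots by `B` multiplies `a_i` by `B⁻ⁱ`, which brings all coefficient norms
      -- down to at most one.
      have h2 := H U (fun i z => B⁻¹ ^ (i.val + 1) * a i z) (fun z => B⁻¹ * r z) hU
        (subset_closure.trans hUU) (fun i => contDiffOn_const.mul (ha.1 i).1) (fun i => by
          have h3 := ((ck1Bound_of_ck1Norm_le (by positivity) (hnorm i)).const_mul hU hUU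
            (ha.1 i).1 (hpos i).le).mono subset_closure le_rfl
          rwa [← mul_pow, inv_mul_cancel₀ hB0.ne', one_pow] at h3) (fun z hz => by
          rw [← monicPoly_scaleRoots fun i => a i z]
          exact (ha.2 z hz).splits.scaleRoots _)
        ⟨continuousOn_const.mul hr.1, fun z hz => by
          rw [← monicPoly_scaleRoots fun i => a i z, IsRoot.def, scaleRoots_eval_mul, hr.2 z hz,
            mul_zero]⟩ x hx y hy
      rw [← mul_sub, abs_mul, abs_of_pos (by positivity : 0 < B⁻¹), inv_mul_le_iff₀ hB0] at h2
      linarith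
    have hlim : Filter.Tendsto (fun B : ℝ => K * B * ‖x - y‖) (𝓝[>] A.toReal)
        (𝓝 (K * A.toReal * ‖x - y‖)) := by
      have : Continuous fun B : ℝ => K * B * ‖x - y‖ := by fun_prop
      exact this.continuousAt.mono_left nhdsWithin_le_nhds
    exact ge_of_tendsto hlim (by filter_upwards [self_mem_nhdsWithin] with B hB using key B hB)
  · refine mul_le_mul_right (iSup_le fun i => ?_) _
    have hi : ck1Norm (n - 1) (closure U₁) (a i) ≤
        ⨆ i : Fin n, ck1Norm (n - 1) (closure U₁) (a i) :=
      le_iSup (fun i : Fin n => ck1Norm (n - 1) (closure U₁) (a i)) i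
    have h1 : 1 / ((i.val : ℝ) + 1) ≤ 1 := by
      rw [div_le_one (by positivity)]
      linarith [i.val.cast_nonneg (α := ℝ)]
    -- For `x ≤ 1` the power is at most `1`; for `x ≥ 1` it is at most `x`, as the exponent is at
    -- most `1`. Thus the same constant serves both inequalities.
    rcases le_total (ck1Norm (n - 1) (closure U₁) (a i)) 1 with h | h
    · exact (ENNReal.rpow_le_one h (by positivity)).trans le_self_add
    · refine le_trans ?_ (hi.trans le_add_self)
      conv_rhs => rw [← ENNReal.rpow_one (ck1Norm (n - 1) (closure U₁) (a i))]
      exact ENNReal.rpow_le_rpow_of_exponent_le h h1
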